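/- **Setting.** Let $n\ge 1$, let $\Omega\subset\mathbb R^n$ be a bounded Lipschitz domain (open, connected), and let $\mathcal M\subset\mathbb R^n$ be a smooth $(n-1)$-dimensional embedded submanifold which divides $\Omega$ into two Lipschitz subdomains: $\Omega\setminus\mathcal M=\Omega_+\cup\Omega_-$ with $\Omega_\pm$ disjoint bounded Lipschitz domains. Let $\mu$ be the surface measure on $\mathcal M\cap\Omega$; integrals and norms over $\mathcal M$ are taken over $\mathcal M\cap\Omega$ with respect to $\mu$, and $\|\cdot\|_S$ is the norm of $L^2(S)$ or $L^2(S,\mathbb R^n)$. Let $\psi:\mathcal M\to\mathbb R$ be smooth, let $\varphi\in H^1(\Omega)$ (an extension of the boundary datum), and put $$\mathbb K=\{v\in H^1(\Omega): v\ge\psi \text{ on }\mathcal M\cap\Omega \text{ in the sense of traces},\ v-\varphi\in H^1_0(\Omega)\}.$$ Let $u\in\mathbb K$ be a minimizer of $J(v)=\frac12\int_\Omega|\nabla v|^2dx$ over $\mathbb K$. Let $H(\Omega_\pm,\mathrm{div})$ be the set of $q^*\in L^2(\Omega,\mathbb R^n)$ such that $\mathrm{div}(q^*|_{\Omega_\pm})\in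 L^2(\Omega_\pm)$ and $[q^*\cdot\mathbf n]\in L^2(\mathcal M)$, where $[q^*\cdot\mathbf n]$ is the sum of the (weak) normal traces of $q^*|_{\Omega_+}$ and $q^*|_{\Omega_-}$ on $\mathcal M$ with respect to the outer normals of $\Omega_+$ and $\Omega_-$; that is, for all $\eta\in C_c^\infty(\Omega)$, $$\sum_{\pm}\int_{\Omega_\pm}\bigl(q^*\cdot\nabla\eta+\eta\,\mathrm{div}\,q^*\bigr)dx=\int_{\mathcal M}[q^*\cdot\mathbf n]\,\eta\,d\mu .$$ Let $C_{F_{\Omega_\pm}}>0$ and $C_{Tr_{\mathcal M}}(\Omega_\pm)>0$ be constants in the Friedrichs type and trace inequalities $$\|w\|_{\Omega_\pm}\le C_{F_{\Omega_\pm}}\|\nabla w\|_{\Omega_\pm},\qquad \|w\|_{\mathcal M}\le C_{Tr_{\mathcal M}}(\Omega_\pm)\|\nabla w\|_{\Omega_\pm}\qquad\text{for all } w\in H^1_0(\Omega),$$ and let $C_{Tr_{\mathcal M}}=\min\{C_{Tr_{\mathcal M}}(\Omega_+),C_{Tr_{\mathcal M}}(\Omega_-)\}$. **Theorem.** For all $v\in\mathbb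 K$, $q^*\in H(\Omega_\pm,\mathrm{div})$ and $\beta_1,\beta_2>0$, $$\|\nabla(v-u)\|_\Omega^2\le \mathfrak M_1+\mathfrak M_3,$$ where $$\mathfrak M_1=(1+\beta_1)\|\nabla v-q^*\|_\Omega^2+(1+\beta_1^{-1})(1+\beta_2)\bigl[C_{F_{\Omega_+}}\|\mathrm{div}\,q^*\|_{\Omega_+}+C_{F_{\Omega_-}}\|\mathrm{div}\,q^*\|_{\Omega_-}\bigr]^2,$$ $$\mathfrak M_3=\int_{\mathcal M}\rho\,d\mu,\qquad c_\beta=\frac{\beta_1\beta_2}{(1+\beta_1)(1+\beta_2)},$$ $$\rho=\begin{cases}(v-\psi)\Bigl(2[q^*\cdot\mathbf n]-\dfrac{c_\beta}{C_{Tr_{\mathcal M}}^2}(v-\psi)\Bigr)&\text{if }[q^*\cdot\mathbf n]\ge\dfrac{c_\beta}{C_{Tr_{\mathcal M}}^2}(v-\psi),\\[2mm]\dfrac{C_{Tr_{\mathcal M}}^2}{c_\beta}[q^*\cdot\mathbf n]^2&\text{if }[q^*\cdot\mathbf n]<\dfrac{c_\beta}{C_{Tr_{\mathcal M}}^2}(v-\psi),\end{cases}$$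 and $\rho$ is integrable on $\mathcal M$. Moreover, $\mathfrak M_1+\mathfrak M_3=0$ if and only if $v=u$ and $q^*=\nabla u$ almost everywhere in $\Omega$. -/

import Mathlib

open MeasureTheory Filter Topology
open scoped ContDiff

namespace ThinObstacle

/-- The Euclidean space `ℝⁿ`. -/
abbrev Euc (n : ℕ) := EuclideanSpace ℝ (Fin n)

noncomputable section

/-! ### Geometry -/

/-- `S` has a Lipschitz boundary: near every boundary point, in suitable orthonormal coordinates,
`S` is the strict epigraph of a Lipschitz function.  Here `e` is the unit vector of the "vertical"
axis, `inner ℝ e y` is the height of `y` and `y - (inner ℝ e y) • e` is the projection of `y` to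
the hyperplane orthogonal to `e`. -/
def HasLipschitzBoundary {n : ℕ} (S : Set (Euc n)) : Prop :=
  ∀ x ∈ frontier S, ∃ (e : Euc n) (U : Set (Euc n)) (γ : Euc n → ℝ) (K : NNReal),
    ‖e‖ = 1 ∧ IsOpen U ∧ x ∈ U ∧ LipschitzWith K γ ∧
    S ∩ U = {y ∈ U | γ (y - (inner ℝ e y) • e) < inner ℝ e y}

/-- `M` is a smooth embedded `(n-1)`-dimensional submanifold of `ℝⁿ`: near each of its points it
is, in suitable orthonormal coordinates, the graph of a smooth function. -/
def IsSmoothHypersurface {n : ℕ} (M : Set (Euc n)) : Prop :=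
  ∀ x ∈ M, ∃ (e : Euc n) (U : Set (Euc n)) (γ : Euc n → ℝ),
    ‖e‖ = 1 ∧ IsOpen U ∧ x ∈ U ∧ ContDiff ℝ ∞ γ ∧
    M ∩ U = {y ∈ U | inner ℝ e y = γ (y - (inner ℝ e y) • e)}

/-- A bounded Lipschitz domain (open, connected, non-empty). -/
structure IsLipschitzDomain {n : ℕ} (S : Set (Euc n)) : Prop where
  isOpen : IsOpen S
  isConnected : IsConnected S
  isBounded : Bornology.IsBounded S
  lipschitz : HasLipschitzBoundary S

/-- The smooth hypersurface `M` divides the bounded Lipschitz domain `Ω` into the two Lipschitz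
subdomains `Ωp` (that is, `Ω₊`) and `Ωm` (that is, `Ω₋`). -/
structure IsDividedDomain {n : ℕ} (Ω Ωp Ωm M : Set (Euc n)) : Prop where
  domain : IsLipschitzDomain Ω
  domain_plus : IsLipschitzDomain Ωp
  domain_minus : IsLipschitzDomain Ωm
  hypersurface : IsSmoothHypersurface M
  disjoint : Disjoint Ωp Ωm
  union_eq : Ωp ∪ Ωm = Ω \ M

/-- `ψ` is a smooth function on the set `M`: near each point of `M` it is the restriction to `M`
of a smooth function on `ℝⁿ`. -/
def IsSmoothOn {n : ℕ} (M : Set (Euc n)) (ψ : Euc n → ℝ) : Prop :=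
  ∀ x ∈ M, ∃ (U : Set (Euc n)) (Ψ : Euc n → ℝ),
    IsOpen U ∧ x ∈ U ∧ ContDiff ℝ ∞ Ψ ∧ ∀ y ∈ M ∩ U, ψ y = Ψ y

/-- The surface measure `μ` on the part of `M` inside `Ω`: the `(n-1)`-dimensional Hausdorff
measure, normalized so as to agree with Lebesgue measure on hyperplanes. -/
def surf {n : ℕ} (Ω M : Set (Euc n)) : Measure (Euc n) :=
  (Measure.euclideanHausdorffMeasure (n - 1)).restrict (M ∩ Ω)

/-! ### Function spaces -/

/-- The `L²` norm with respect to `ν`, as a real number. -/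
def l2norm {n : ℕ} {F : Type*} [NormedAddCommGroup F] (ν : Measure (Euc n)) (f : Euc n → F) : ℝ :=
  (eLpNorm f 2 ν).toReal

/-- `η ∈ C_c^∞(S)`. -/
structure IsTest {n : ℕ} (S : Set (Euc n)) (η : Euc n → ℝ) : Prop where
  smooth : ContDiff ℝ ∞ η
  compact : HasCompactSupport η
  support : tsupport η ⊆ S

/-- `v ∈ H¹(S)` with weak gradient `Dv`. -/
structure IsH1 {n : ℕ} (S : Set (Euc n)) (v : Euc n → ℝ) (Dv : Euc n → Euc n) : Prop where
  memLp : MemLp v 2 (volume.restrict S)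
  memLp_grad : MemLp Dv 2 (volume.restrict S)
  weak : ∀ η, IsTest S η → ∫ x in S, v x • gradient η x = -∫ x in S, η x • Dv x

/-- `η k → v` in `H¹(S)`, where `Dv` is the weak gradient of `v` and the `η k` are smooth. -/
def TendstoH1 {n : ℕ} (S : Set (Euc n)) (η : ℕ → Euc n → ℝ) (v : Euc n → ℝ)
    (Dv : Euc n → Euc n) : Prop :=
  Tendsto (fun k => eLpNorm (fun x => η k x - v x) 2 (volume.restrict S)) atTop (𝓝 0) ∧
  Tendsto (fun k => eLpNorm (fun x => gradient (η k) x - Dv x) 2 (volume.restrict S)) atTop (𝓝 0)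

/-- `v ∈ H¹₀(S)` with weak gradient `Dv`: `v` is an `H¹` limit of functions in `C_c^∞(S)`. -/
def IsH10 {n : ℕ} (S : Set (Euc n)) (v : Euc n → ℝ) (Dv : Euc n → Euc n) : Prop :=
  IsH1 S v Dv ∧ ∃ η : ℕ → Euc n → ℝ, (∀ k, IsTest S (η k)) ∧ TendstoH1 S η v Dv

/-- `g ∈ L²(M)` is the trace on `M` of `v ∈ H¹(Ω)` (with weak gradient `Dv`): there are
`η k ∈ C_c^∞(ℝⁿ)` with `η k → v` in `H¹(Ω)` and `η k → g` in `L²(M)`.  That is, the trace operator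
is the extension by continuity of the restriction `η ↦ η|_M`. -/
def IsTrace {n : ℕ} (Ω M : Set (Euc n)) (v : Euc n → ℝ) (Dv : Euc n → Euc n)
    (g : Euc n → ℝ) : Prop :=
  MemLp g 2 (surf Ω M) ∧
  ∃ η : ℕ → Euc n → ℝ, (∀ k, IsTest Set.univ (η k)) ∧ TendstoH1 Ω η v Dv ∧
    Tendsto (fun k => eLpNorm (fun x => η k x - g x) 2 (surf Ω M)) atTop (𝓝 0)

/-- `d ∈ L²(S)` is the weak divergence of `q` on `S`. -/
def IsWeakDiv {n : ℕ} (S : Set (Euc n)) (q : Euc n → Euc n) (d : Euc n → ℝ) : Prop :=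
  MemLp d 2 (volume.restrict S) ∧
  ∀ η, IsTest S η → ∫ x in S, inner ℝ (q x) (gradient η x) = -∫ x in S, d x * η x

/-- The pairing `⟨q·n_S, η⟩` of the (weak) outward normal trace of `q` on `∂S` with `η`, where `d`
is the weak divergence of `q` on `S`. It is defined, as usual, by Green's formula. -/
def normalTrace {n : ℕ} (S : Set (Euc n)) (q : Euc n → Euc n) (d : Euc n → ℝ)
    (η : Euc n → ℝ) : ℝ :=
  (∫ x in S, inner ℝ (q x) (gradient η x)) + ∫ x in S, d x * η x

/-- `q ∈ H(Ω_±, div)`, with divergence `d` on `Ω₊ ∪ Ω₋` and with jump `j = [q·n] ∈ L²(M)`; the jump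
is the sum of the outward normal traces of `q|_{Ω₊}` and `q|_{Ω₋}` on `M`. -/
structure IsHDiv {n : ℕ} (Ω Ωp Ωm M : Set (Euc n)) (q : Euc n → Euc n) (d j : Euc n → ℝ) :
    Prop where
  memLp : MemLp q 2 (volume.restrict Ω)
  div_plus : IsWeakDiv Ωp q d
  div_minus : IsWeakDiv Ωm q d
  memLp_jump : MemLp j 2 (surf Ω M)
  jump : ∀ η, IsTest Ω η →
    normalTrace Ωp q d η + normalTrace Ωm q d η = ∫ x, j x * η x ∂(surf Ω M)

/-! ### The thin obstacle problem -/

/-- `v ∈ 𝕂`, with weak gradient `Dv`: `v ∈ H¹(Ω)`, `v = φ` on `∂Ω` (that is, `v - φ ∈ H¹₀(Ω)`),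
and `v ≥ ψ` on `M ∩ Ω` in the sense of traces. -/
def IsAdmissible {n : ℕ} (Ω M : Set (Euc n)) (φ : Euc n → ℝ) (Dφ : Euc n → Euc n)
    (ψ : Euc n → ℝ) (v : Euc n → ℝ) (Dv : Euc n → Euc n) : Prop :=
  IsH1 Ω v Dv ∧ IsH10 Ω (fun x => v x - φ x) (fun x => Dv x - Dφ x) ∧
  ∃ g, IsTrace Ω M v Dv g ∧ ∀ᵐ x ∂(surf Ω M), ψ x ≤ g x

/-- The Dirichlet energy `J(v) = ½ ∫_Ω |∇v|²`, as a function of the gradient `Dv`. -/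
def energy {n : ℕ} (Ω : Set (Euc n)) (Dv : Euc n → Euc n) : ℝ :=
  (1 / 2) * ∫ x in Ω, ‖Dv x‖ ^ 2

/-- `u`, with weak gradient `Du`, minimizes the Dirichlet energy over `𝕂`. -/
def IsMinimizer {n : ℕ} (Ω M : Set (Euc n)) (φ : Euc n → ℝ) (Dφ : Euc n → Euc n)
    (ψ : Euc n → ℝ) (u : Euc n → ℝ) (Du : Euc n → Euc n) : Prop :=
  IsAdmissible Ω M φ Dφ ψ u Du ∧
  ∀ v Dv, IsAdmissible Ω M φ Dφ ψ v Dv → energy Ω Du ≤ energy Ω Dv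

/-! ### Constants and majorants -/

/-- `C > 0` is a constant in the Friedrichs type inequality `‖w‖_S ≤ C ‖∇w‖_S`, for `w ∈ H¹₀(Ω)`,
where `S` is `Ω₊` or `Ω₋`. -/
def IsFriedrichsConst {n : ℕ} (Ω S : Set (Euc n)) (C : ℝ) : Prop :=
  0 < C ∧ ∀ w Dw, IsH10 Ω w Dw →
    l2norm (volume.restrict S) w ≤ C * l2norm (volume.restrict S) Dw

/-- `C > 0` is a constant in the trace inequality `‖w‖_M ≤ C ‖∇w‖_S`, for `w ∈ H¹₀(Ω)`, where `S`
is `Ω₊` or `Ω₋`. -/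
def IsTraceConst {n : ℕ} (Ω M S : Set (Euc n)) (C : ℝ) : Prop :=
  0 < C ∧ ∀ w Dw g, IsH10 Ω w Dw → IsTrace Ω M w Dw g →
    l2norm (surf Ω M) g ≤ C * l2norm (volume.restrict S) Dw

/-- `c_β = β₁ β₂ (1 + β₁)⁻¹ (1 + β₂)⁻¹`. -/
def cBeta (β₁ β₂ : ℝ) : ℝ := β₁ * β₂ * (1 + β₁)⁻¹ * (1 + β₂)⁻¹

/-- `𝔐₁`, where `d` is the divergence of `q` on `Ω₊ ∪ Ω₋`. -/
def majorant₁ {n : ℕ} (Ω Ωp Ωm : Set (Euc n)) (CFp CFm β₁ β₂ : ℝ) (Dv q : Euc n → Euc n)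
    (d : Euc n → ℝ) : ℝ :=
  (1 + β₁) * l2norm (volume.restrict Ω) (fun x => Dv x - q x) ^ 2 +
  (1 + β₁⁻¹) * (1 + β₂) *
    (CFp * l2norm (volume.restrict Ωp) d + CFm * l2norm (volume.restrict Ωm) d) ^ 2

/-- The integrand `ρ`, as a function of the value `t` of `v - ψ`, of the value `j` of `[q·n]`, of
`c = c_β` and of the trace constant `C`. -/
def rho (C c t j : ℝ) : ℝ :=
  if c / C ^ 2 * t ≤ j then t * (2 * j - c / C ^ 2 * t) else C ^ 2 / c * j ^ 2

/-- `𝔐₃ = ∫_M ρ dμ`, where `g` is the trace of `v` on `M` and `j = [q·n]`. -/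
def majorant₃ {n : ℕ} (Ω M : Set (Euc n)) (C β₁ β₂ : ℝ) (g ψ j : Euc n → ℝ) : ℝ :=
  ∫ x, rho C (cBeta β₁ β₂) (g x - ψ x) (j x) ∂(surf Ω M)

end

end ThinObstacle

/-! Put `w = v - u` and `N = ‖∇w‖`. Then `N²` equals `∫ (∇v - q)·∇w + ∫ q·∇w - ∫ ∇u·∇w`, and the
last integral is nonnegative by the variational inequality (`IsMinimizer.integral_inner_nonneg`).
Green's formula (`IsHDiv.integral_inner_add`) turns `∫ q·∇w` into volume terms with `div q`,
controlled by the Friedrichs inequalities, and the surface term `∫_M j w`, where `j` is the jump.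

On `M` the only one-sided information is `w ≤ t := v - ψ`, because `u ≥ ψ`. So write `j = (j - m) +
m` with `m ≤ j`: the first part is bounded using `w ≤ t`, the second by Cauchy-Schwarz and the trace
inequality, giving `D N` with `D = C ‖m‖`. The pointwise cost `2(j - m)t + (C²/c)m²` is least, among
`m ≤ j`, at `m = min(j, c t / C²)`; its value there is `ρ` (`rho_eq`). Completing the square in `N`
and applying Young's inequality twice (`sq_add_add_le`) gives the estimate, since the term `D²/c_β`
produced by Young is exactly the one already contained in `∫ρ`.

Both majorants are nonnegative. If their sum vanishes, the estimate gives `∇v = ∇u`, the Friedrichs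
inequalities give `v = u`, and `𝔐₁ = 0` gives `q = ∇v`. Conversely, for `q = ∇u` the optimality
conditions of the thin obstacle problem hold: `div q = 0` on both pieces
(`IsMinimizer.ae_div_eq_zero`), `j ≥ 0`, and `j (u - ψ) = 0` on `M`
(`IsMinimizer.ae_complementarity`). Under these conditions every term vanishes. -/

namespace ThinObstacle

/-! ### Square-integrable functions -/

section Norm

variable {n : ℕ} {G : Type*} [NormedAddCommGroup G] {ν : Measure (Euc n)} {f : Euc n → G}

theorem l2norm_nonneg (ν : Measure (Euc n)) (f : Euc n → G) :
    0 ≤ l2norm ν f :=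
  ENNReal.toReal_nonneg

theorem l2norm_mono {μ : Measure (Euc n)} (hμ : μ ≤ ν) (hf : MemLp f 2 ν) :
    l2norm μ f ≤ l2norm ν f :=
  ENNReal.toReal_mono hf.eLpNorm_ne_top (eLpNorm_mono_measure f hμ)

theorem ae_eq_zero_of_l2norm_eq_zero (hf : MemLp f 2 ν) (h : l2norm ν f = 0) : f =ᵐ[ν] 0 := by
  rw [l2norm, ENNReal.toReal_eq_zero_iff] at h
  exact (eLpNorm_eq_zero_iff hf.1 two_ne_zero).1 (h.resolve_right hf.eLpNorm_ne_top)

theorem l2norm_eq_zero_of_ae_eq_zero (h : f =ᵐ[ν] 0) : l2norm ν f = 0 := by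
  rw [l2norm, eLpNorm_congr_ae h]
  simp

end Norm

section L2

variable {n : ℕ} {F : Type*} [NormedAddCommGroup F] [InnerProductSpace ℝ F]
  {ν : Measure (Euc n)} {f g : Euc n → F}

theorem inner_toLp (hf : MemLp f 2 ν) (hg : MemLp g 2 ν) :
    inner ℝ (hf.toLp f) (hg.toLp g) = ∫ x, inner ℝ (f x) (g x) ∂ν := by
  rw [L2.inner_def]
  apply integral_congr_ae
  filter_upwards [hf.coeFn_toLp, hg.coeFn_toLp] with x h1 h2
  rw [h1, h2]

theorem integrable_inner (hf : MemLp f 2 ν) (hg : MemLp g 2 ν) :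
    Integrable (fun x => inner ℝ (f x) (g x)) ν := by
  refine (L2.integrable_inner (𝕜 := ℝ) (hf.toLp f) (hg.toLp g)).congr ?_
  filter_upwards [hf.coeFn_toLp, hg.coeFn_toLp] with x h1 h2
  rw [h1, h2]

theorem abs_integral_inner_le (hf : MemLp f 2 ν) (hg : MemLp g 2 ν) :
    |∫ x, inner ℝ (f x) (g x) ∂ν| ≤ l2norm ν f * l2norm ν g := by
  rw [← inner_toLp hf hg, l2norm, l2norm, ← Lp.norm_toLp f hf, ← Lp.norm_toLp g hg]
  exact abs_real_inner_le_norm _ _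

theorem integrable_mul_of_memLp {f g : Euc n → ℝ} (hf : MemLp f 2 ν) (hg : MemLp g 2 ν) :
    Integrable (fun x => f x * g x) ν :=
  (integrable_inner hg hf).congr (.of_forall fun x => by simp)

theorem abs_integral_mul_le {f g : Euc n → ℝ} (hf : MemLp f 2 ν) (hg : MemLp g 2 ν) :
    |∫ x, f x * g x ∂ν| ≤ l2norm ν f * l2norm ν g := by
  have := abs_integral_inner_le hg hf
  simpa [mul_comm (l2norm ν g)] using this

theorem l2norm_sq (hf : MemLp f 2 ν) : l2norm ν f ^ 2 = ∫ x, ‖f x‖ ^ 2 ∂ν := by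
  have := inner_toLp hf hf
  simp only [real_inner_self_eq_norm_sq, Lp.norm_toLp] at this
  exact this

theorem tendsto_integral_inner {η : ℕ → Euc n → F} (hη : ∀ k, MemLp (η k) 2 ν) (hf : MemLp f 2 ν)
    (hg : MemLp g 2 ν) (h : Tendsto (fun k => eLpNorm (fun x => η k x - f x) 2 ν) atTop (𝓝 0)) :
    Tendsto (fun k => ∫ x, inner ℝ (η k x) (g x) ∂ν) atTop (𝓝 (∫ x, inner ℝ (f x) (g x) ∂ν)) := by
  have h' : Tendsto (fun k => l2norm ν (fun x => η k x - f x) * l2norm ν g) atTop (𝓝 0) := by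
    have := ((ENNReal.tendsto_toReal ENNReal.zero_ne_top).comp h).mul_const (l2norm ν g)
    rwa [ENNReal.toReal_zero, zero_mul] at this
  rw [tendsto_iff_norm_sub_tendsto_zero]
  refine squeeze_zero (fun _ => norm_nonneg _) (fun k => ?_) h'
  rw [← integral_sub (integrable_inner (hη k) hg) (integrable_inner hf hg)]
  simp_rw [← inner_sub_left]
  exact abs_integral_inner_le ((hη k).sub hf) hg

theorem tendsto_integral_mul {η : ℕ → Euc n → ℝ} {f g : Euc n → ℝ} (hη : ∀ k, MemLp (η k) 2 ν)
    (hf : MemLp f 2 ν) (hg : MemLp g 2 ν)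
    (h : Tendsto (fun k => eLpNorm (fun x => η k x - f x) 2 ν) atTop (𝓝 0)) :
    Tendsto (fun k => ∫ x, g x * η k x ∂ν) atTop (𝓝 (∫ x, g x * f x ∂ν)) := by
  simpa using tendsto_integral_inner hη hf hg h

/-- Sequences that converge in `L²` can be combined linearly. -/
theorem tendsto_eLpNorm_add_smul {η ζ : ℕ → Euc n → F} (c : ℝ)
    (hη : ∀ k, AEStronglyMeasurable (fun x => η k x - f x) ν)
    (hζ : ∀ k, AEStronglyMeasurable (fun x => ζ k x - g x) ν)
    (h1 : Tendsto (fun k => eLpNorm (fun x => η k x - f x) 2 ν) atTop (𝓝 0))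
    (h2 : Tendsto (fun k => eLpNorm (fun x => ζ k x - g x) 2 ν) atTop (𝓝 0)) :
    Tendsto (fun k => eLpNorm (fun x => (η k x + c • ζ k x) - (f x + c • g x)) 2 ν) atTop
      (𝓝 0) := by
  have h3 : Tendsto (fun k => eLpNorm (fun x => η k x - f x) 2 ν +
      ‖c‖ₑ * eLpNorm (fun x => ζ k x - g x) 2 ν) atTop (𝓝 0) := by
    have := h1.add (ENNReal.Tendsto.const_mul (a := ‖c‖ₑ) h2 (Or.inr enorm_ne_top))
    simpa using this
  refine tendsto_of_tendsto_of_tendsto_of_le_of_le tendsto_const_nhds h3 (fun _ => zero_le)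
    fun k => ?_
  have e : (fun x => (η k x + c • ζ k x) - (f x + c • g x)) =
      (fun x => η k x - f x) + c • (fun x => ζ k x - g x) := by
    ext1 x
    simp only [Pi.add_apply, Pi.smul_apply, smul_sub]
    abel
  rw [e]
  refine (eLpNorm_add_le (hη k) ((hζ k).const_smul c) (by norm_num)).trans ?_
  rw [eLpNorm_const_smul]

end L2

end ThinObstacle
namespace ThinObstacle

/-! ### Smooth hypersurfaces -/

section Hypersurface

variable {n : ℕ}

/-- Vertical translates of a graph by distinct heights are disjoint. The heights `1/(k+1)` give
infinitely many such translates within a bounded range, which forces measure zero. -/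
theorem volume_graph_eq_zero {e : Euc n} (he : ‖e‖ = 1) {γ : Euc n → ℝ} (hγ : Continuous γ) :
    volume {y : Euc n | inner ℝ e y = γ (y - (inner ℝ e y) • e)} = 0 := by
  have hee : inner ℝ e e = (1 : ℝ) := by rw [real_inner_self_eq_norm_sq, he, one_pow]
  refine Measure.addHaar_eq_zero_of_disjoint_translates volume
    (fun k : ℕ => ((1 : ℝ) / (k + 1)) • e) ?_ ?_ ?_
  · refine (Metric.isBounded_closedBall (x := (0 : Euc n)) (r := 1)).subset ?_
    rintro _ ⟨k, rfl⟩
    rw [mem_closedBall_zero_iff, norm_smul, he, mul_one, Real.norm_eq_abs,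
      abs_of_nonneg (by positivity)]
    exact Nat.one_div_le_one_div (α := ℝ) (Nat.zero_le k) |>.trans (by simp)
  · intro k l hkl
    rw [Function.onFun, Set.disjoint_left]
    rintro _ hk hl
    rw [Set.singleton_add, Set.mem_image] at hk hl
    obtain ⟨y, hy, rfl⟩ := hk
    obtain ⟨z, hz, hzy⟩ := hl
    apply hkl
    have hproj : z - (inner ℝ e z) • e = y - (inner ℝ e y) • e := by
      have hz' : z = ((1 : ℝ) / (k + 1) - (1 : ℝ) / (l + 1)) • e + y := by
        rw [sub_smul, ← sub_eq_zero] at *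
        rw [← hzy]; abel
      rw [hz', inner_add_right, inner_smul_right, hee, mul_one, add_smul]
      abel
    have hin : (inner ℝ e z : ℝ) = inner ℝ e y := by
      rw [Set.mem_ofPred_eq] at hy hz
      rw [hy, hz, hproj]
    have := congrArg (inner ℝ e) hzy
    rw [inner_add_right, inner_add_right, inner_smul_right, inner_smul_right, hee, hin] at this
    have h2 : (1 : ℝ) / (l + 1) = 1 / (k + 1) := by linarith
    have h4 : (l : ℝ) = k := by
      field_simp at h2
      linarith
    exact_mod_cast h4.symm
  · exact (isClosed_eq (by fun_prop) (by fun_prop)).measurableSet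

theorem IsSmoothHypersurface.volume_eq_zero {M : Set (Euc n)} (hM : IsSmoothHypersurface M) :
    volume M = 0 := by
  refine measure_null_of_locally_null M fun x hx => ?_
  obtain ⟨e, U, γ, he, hU, hxU, hγ, hMU⟩ := hM x hx
  refine ⟨M ∩ U, inter_mem_nhdsWithin M (hU.mem_nhds hxU), measure_mono_null ?_
    (volume_graph_eq_zero he hγ.continuous)⟩
  rw [hMU]
  exact fun y hy => hy.2

/-- The bounded piece of the graph lies in the image of a ball of the hyperplane `e⊥`, of dimension
`n - 1`, under `z ↦ z + γ(z) e`. This map is `C¹`, hence Lipschitz on the compact convex ball, and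
Lipschitz maps preserve finiteness of Hausdorff measure. -/
theorem hausdorffMeasure_graph_inter_closedBall_lt_top (hn : 1 ≤ n) {e : Euc n} (he : ‖e‖ = 1)
    {γ : Euc n → ℝ} (hγ : ContDiff ℝ 1 γ) (x : Euc n) (r : ℝ) :
    Measure.euclideanHausdorffMeasure (n - 1)
      ({y : Euc n | inner ℝ e y = γ (y - (inner ℝ e y) • e)} ∩ Metric.closedBall x r) < ⊤ := by
  have hee : inner ℝ e e = (1 : ℝ) := by rw [real_inner_self_eq_norm_sq, he, one_pow]
  let W : Submodule ℝ (Euc n) := (ℝ ∙ e)ᗮ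
  have hW : Module.finrank ℝ W = n - 1 := by
    have : Fact (Module.finrank ℝ (Euc n) = (n - 1) + 1) := ⟨by simp; omega⟩
    exact Submodule.finrank_orthogonal_span_singleton (by rintro rfl; simp at he)
  let f : W → Euc n := fun z => (z : Euc n) + γ z • e
  have hf : ContDiff ℝ 1 f := by
    have h : ContDiff ℝ 1 (fun z : W => (z : Euc n)) := W.subtypeL.contDiff
    exact h.add ((hγ.comp h).smul contDiff_const)
  let R : ℝ := ‖x‖ + |r|
  obtain ⟨K, hK⟩ := (hf.contDiffOn (s := Metric.closedBall (0 : W) R)).exists_lipschitzOnWith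
    one_ne_zero (convex_closedBall _ _) (isCompact_closedBall _ _)
  have hsub : ({y : Euc n | inner ℝ e y = γ (y - (inner ℝ e y) • e)} ∩ Metric.closedBall x r) ⊆
      f '' Metric.closedBall (0 : W) R := by
    rintro y ⟨hy, hyr⟩
    have hyW : y - (inner ℝ e y) • e ∈ W := by
      rw [Submodule.mem_orthogonal_singleton_iff_inner_right, inner_sub_right, inner_smul_right, hee]
      ring
    refine ⟨⟨_, hyW⟩, ?_, ?_⟩
    · rw [mem_closedBall_zero_iff, Submodule.coe_norm]
      have h1 : ‖y - (inner ℝ e y) • e‖ ^ 2 = ‖y‖ ^ 2 - (inner ℝ e y) ^ 2 := by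
        rw [norm_sub_sq_real, inner_smul_right, norm_smul, he, real_inner_comm y e,
          Real.norm_eq_abs, mul_one, sq_abs]
        ring
      have h2 : ‖y - (inner ℝ e y) • e‖ ≤ ‖y‖ :=
        pow_le_pow_iff_left₀ (norm_nonneg _) (norm_nonneg _) two_ne_zero |>.1
          (by rw [h1]; nlinarith [sq_nonneg (inner ℝ e y : ℝ)])
      refine h2.trans ?_
      have h3 : ‖y - x‖ ≤ r := by simpa [dist_eq_norm] using hyr
      have h4 := norm_le_norm_add_norm_sub' y x
      have := le_abs_self r
      change ‖y‖ ≤ ‖x‖ + |r|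
      linarith
    · change y - (inner ℝ e y) • e + γ (y - (inner ℝ e y) • e) • e = y
      rw [← (show inner ℝ e y = γ (y - (inner ℝ e y) • e) from hy)]
      abel
  refine (measure_mono hsub).trans_lt ?_
  have hfin : Measure.euclideanHausdorffMeasure (n - 1) (Metric.closedBall (0 : W) R) < ⊤ := by
    rw [← hW, InnerProductSpace.euclideanHausdorffMeasure_eq_volume]
    exact measure_closedBall_lt_top
  -- The Lipschitz bound concerns the unnormalized Hausdorff measure. The normalizing factor is
  -- positive, so finiteness passes between the two.
  rw [Measure.euclideanHausdorffMeasure_def, Measure.smul_apply] at hfin ⊢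
  have hs := (Measure.addHaarScalarFactor_pos_of_isAddHaarMeasure (volume : Measure (Euc (n-1))) (Measure.hausdorffMeasure (n - 1 : ℕ)))
  have hfin' := ENNReal.lt_top_of_mul_ne_top_right hfin.ne (by simpa using hs.ne')
  refine ENNReal.mul_lt_top (by simp) ?_
  refine (hK.hausdorffMeasure_image_le (Nat.cast_nonneg _)).trans_lt ?_
  exact ENNReal.mul_lt_top (ENNReal.rpow_lt_top_of_nonneg (Nat.cast_nonneg _) (by simp)) hfin'

variable {Ω Ωp Ωm M : Set (Euc n)}

theorem IsDividedDomain.union_subset (h : IsDividedDomain Ω Ωp Ωm M) : Ωp ∪ Ωm ⊆ Ω := by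
  rw [h.union_eq]
  exact Set.sdiff_subset

theorem IsDividedDomain.plus_subset (h : IsDividedDomain Ω Ωp Ωm M) : Ωp ⊆ Ω :=
  Set.subset_union_left.trans h.union_subset

theorem IsDividedDomain.minus_subset (h : IsDividedDomain Ω Ωp Ωm M) : Ωm ⊆ Ω :=
  Set.subset_union_right.trans h.union_subset

/-- `M` itself is not assumed closed or measurable. Inside `Ω` it is the complement of two open
sets, which supplies measurability and relative closedness. -/
theorem IsDividedDomain.inter_eq (h : IsDividedDomain Ω Ωp Ωm M) :
    M ∩ Ω = Ω ∩ (Ωp ∪ Ωm)ᶜ := by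
  rw [h.union_eq]
  ext x
  simp only [Set.mem_inter_iff, Set.mem_compl_iff, Set.mem_sdiff]
  tauto

theorem IsDividedDomain.measurableSet_inter (h : IsDividedDomain Ω Ωp Ωm M) :
    MeasurableSet (M ∩ Ω) := by
  rw [h.inter_eq]
  exact h.domain.isOpen.measurableSet.inter
    (h.domain_plus.isOpen.union h.domain_minus.isOpen).measurableSet.compl

/-- By relative closedness, the part of `M` in `K` is compact, so it suffices to bound the measure
locally, where `M` is a graph. This is what puts test functions in `L²(M)`. -/
theorem IsDividedDomain.surf_lt_top (hn : 1 ≤ n) (h : IsDividedDomain Ω Ωp Ωm M)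
    {K : Set (Euc n)} (hK : IsCompact K) (hKΩ : K ⊆ Ω) : surf Ω M K < ⊤ := by
  have hc : IsCompact (K ∩ (Ωp ∪ Ωm)ᶜ) :=
    hK.inter_right (h.domain_plus.isOpen.union h.domain_minus.isOpen).isClosed_compl
  have hsub : K ∩ (M ∩ Ω) ⊆ K ∩ (Ωp ∪ Ωm)ᶜ := by
    rw [h.inter_eq]
    exact fun x hx => ⟨hx.1, hx.2.2⟩
  have hM : K ∩ (Ωp ∪ Ωm)ᶜ ⊆ M := fun x hx => by
    have : x ∈ M ∩ Ω := by
      rw [h.inter_eq]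
      exact ⟨hKΩ hx.1, hx.2⟩
    exact this.1
  rw [surf, Measure.restrict_apply hK.measurableSet]
  refine (measure_mono hsub).trans_lt ?_
  refine hc.measure_lt_top_of_nhdsWithin fun x hx => ?_
  obtain ⟨e, U, γ, he, hU, hxU, hγ, hMU⟩ := h.hypersurface x (hM hx)
  have hnhds : (K ∩ (Ωp ∪ Ωm)ᶜ) ∩ (U ∩ Metric.closedBall x 1) ∈ 𝓝[K ∩ (Ωp ∪ Ωm)ᶜ] x :=
    inter_mem_nhdsWithin _ (inter_mem (hU.mem_nhds hxU) (Metric.closedBall_mem_nhds x one_pos))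
  refine ⟨_, hnhds, lt_of_le_of_lt (measure_mono fun y hy => ?_)
    (hausdorffMeasure_graph_inter_closedBall_lt_top hn he (hγ.of_le (by simp)) x 1)⟩
  have : y ∈ M ∩ U := ⟨hM hy.1, hy.2.1⟩
  rw [hMU] at this
  exact ⟨this.2, hy.2.2⟩

theorem IsDividedDomain.restrict_eq (h : IsDividedDomain Ω Ωp Ωm M) :
    volume.restrict Ω = volume.restrict (Ωp ∪ Ωm) := by
  rw [h.union_eq]
  refine (Measure.restrict_congr_set ?_).symm
  exact sdiff_null_ae_eq_self h.hypersurface.volume_eq_zero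

end Hypersurface

end ThinObstacle
namespace ThinObstacle

/-! ### Test functions -/

section Test

variable {n : ℕ} {S T : Set (Euc n)} {η ζ : Euc n → ℝ}

theorem IsTest.mono (h : IsTest S η) (hST : S ⊆ T) : IsTest T η :=
  ⟨h.smooth, h.compact, h.support.trans hST⟩

theorem IsTest.add_smul (hη : IsTest S η) (hζ : IsTest S ζ) (c : ℝ) :
    IsTest S (fun x => η x + c * ζ x) where
  smooth := hη.smooth.add (contDiff_const.mul hζ.smooth)
  compact := hη.compact.add hζ.compact.mul_left
  support := by
    refine (tsupport_add η fun x => c * ζ x).trans (Set.union_subset hη.support ?_)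
    exact (tsupport_mul_subset_right (f := fun _ => c)).trans hζ.support

theorem IsTest.mul (hη : IsTest S η) (hζ : ContDiff ℝ ∞ ζ) : IsTest S (fun x => η x * ζ x) where
  smooth := hη.smooth.mul hζ
  compact := hη.compact.mul_right
  support := (tsupport_mul_subset_left (g := ζ)).trans hη.support

theorem IsTest.differentiable (h : IsTest S η) : Differentiable ℝ η :=
  h.smooth.differentiable (by simp)

theorem IsTest.continuous_gradient (h : IsTest S η) : Continuous (gradient η) :=
  (InnerProductSpace.toDual ℝ (Euc n)).symm.continuous.comp
    (h.smooth.continuous_fderiv (by simp))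

theorem IsTest.hasCompactSupport_gradient (h : IsTest S η) : HasCompactSupport (gradient η) :=
  (h.compact.fderiv (𝕜 := ℝ)).comp_left (map_zero _)

theorem IsTest.gradient_eq_zero (h : IsTest S η) {x : Euc n} (hx : x ∉ S) : gradient η x = 0 := by
  have : x ∉ tsupport η := fun hx' => hx (h.support hx')
  have h2 : fderiv ℝ η x = 0 := by
    by_contra h3
    exact this (support_fderiv_subset ℝ h3)
  rw [gradient, h2, map_zero]

theorem IsTest.eq_zero (h : IsTest S η) {x : Euc n} (hx : x ∉ S) : η x = 0 :=
  image_eq_zero_of_notMem_tsupport fun hx' => hx (h.support hx')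

theorem gradient_add_smul (hη : Differentiable ℝ η) (hζ : Differentiable ℝ ζ) (c : ℝ) (x : Euc n) :
    gradient (fun x => η x + c * ζ x) x = gradient η x + c • gradient ζ x := by
  rw [gradient, fderiv_fun_add (hη x) ((hζ x).const_mul c), fderiv_const_mul (hζ x)]
  simp [gradient]

theorem gradient_mul (hη : Differentiable ℝ η) (hζ : Differentiable ℝ ζ) (x : Euc n) :
    gradient (fun x => η x * ζ x) x = η x • gradient ζ x + ζ x • gradient η x := by
  rw [gradient, fderiv_fun_mul (hη x) (hζ x)]
  simp [gradient]

theorem inner_gradient (η : Euc n → ℝ) (x w : Euc n) :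
    inner ℝ w (gradient η x) = fderiv ℝ η x w := by
  rw [real_inner_comm, gradient, InnerProductSpace.toDual_symm_apply]

theorem IsTest.memLp (h : IsTest S η) (T : Set (Euc n)) : MemLp η 2 (volume.restrict T) :=
  (h.smooth.continuous.memLp_of_hasCompactSupport h.compact).mono_measure Measure.restrict_le_self

theorem IsTest.memLp_gradient (h : IsTest S η) (T : Set (Euc n)) :
    MemLp (gradient η) 2 (volume.restrict T) :=
  (h.continuous_gradient.memLp_of_hasCompactSupport h.hasCompactSupport_gradient).mono_measure
    Measure.restrict_le_self

theorem IsTest.exists_bound (h : IsTest S η) :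
    ∃ C, 0 ≤ C ∧ (∀ x, ‖η x‖ ≤ C) ∧ ∀ x, ‖gradient η x‖ ≤ C := by
  obtain ⟨C, hC⟩ := h.compact.exists_bound_of_continuous h.smooth.continuous
  obtain ⟨D, hD⟩ := h.hasCompactSupport_gradient.exists_bound_of_continuous h.continuous_gradient
  refine ⟨max C D, ?_, fun x => (hC x).trans (le_max_left _ _),
    fun x => (hD x).trans (le_max_right _ _)⟩
  exact (norm_nonneg _).trans ((hC 0).trans (le_max_left _ _))

theorem IsTest.memLp_surf {Ω Ωp Ωm M : Set (Euc n)} (hn : 1 ≤ n) (h : IsDividedDomain Ω Ωp Ωm M)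
    (hη : IsTest Ω η) : MemLp η 2 (surf Ω M) := by
  have : IsFiniteMeasure ((surf Ω M).restrict (tsupport η)) :=
    ⟨by simpa using h.surf_lt_top hn hη.compact hη.support⟩
  obtain ⟨C, -, hC, -⟩ := hη.exists_bound
  have h1 : MemLp η 2 ((surf Ω M).restrict (tsupport η)) :=
    MemLp.of_bound hη.smooth.continuous.aestronglyMeasurable C (.of_forall hC)
  rw [← memLp_indicator_iff_restrict (isClosed_tsupport η).measurableSet] at h1
  rwa [Set.indicator_eq_self.2 (subset_tsupport η)] at h1

/-- Integration by parts against a test function. -/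
theorem IsTest.integral_mul_gradient (hη : IsTest T η) (hζ : IsTest S ζ) (w : Euc n) :
    ∫ x in S, η x * inner ℝ w (gradient ζ x) = -∫ x in S, ζ x * inner ℝ w (gradient η x) := by
  rw [setIntegral_eq_integral_of_forall_compl_eq_zero fun x hx => by simp [hζ.gradient_eq_zero hx],
    setIntegral_eq_integral_of_forall_compl_eq_zero fun x hx => by simp [hζ.eq_zero hx]]
  have hcη := hη.smooth.continuous
  have hcζ := hζ.smooth.continuous
  have hdη : Continuous fun x => fderiv ℝ η x w :=
    (hη.smooth.continuous_fderiv (by simp)).clm_apply continuous_const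
  have hdζ : Continuous fun x => fderiv ℝ ζ x w :=
    (hζ.smooth.continuous_fderiv (by simp)).clm_apply continuous_const
  simp only [inner_gradient]
  rw [integral_mul_fderiv_eq_neg_fderiv_mul_of_integrable
    ((hdη.mul hcζ).integrable_of_hasCompactSupport hζ.compact.mul_left)
    ((hcη.mul hdζ).integrable_of_hasCompactSupport hη.compact.mul_right)
    ((hcη.mul hcζ).integrable_of_hasCompactSupport hζ.compact.mul_left)
    (fun x _ => hη.differentiable x) (fun x _ => hζ.differentiable x)]
  simp only [mul_comm]

end Test

/-! ### Sobolev functions -/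

section Sobolev

variable {n : ℕ} {S T : Set (Euc n)} {v w : Euc n → ℝ} {Dv Dw : Euc n → Euc n}

theorem memLp_inner_left {ν : Measure (Euc n)} (hw : MemLp Dw 2 ν) (a : Euc n) :
    MemLp (fun x => inner ℝ a (Dw x)) 2 ν :=
  hw.const_inner (𝕜 := ℝ) a

/-- Pairing with constant vectors reduces vector-valued integration by parts to scalar identities,
to which the `L²` limit lemmas apply. -/
theorem integral_smul_gradient_eq_iff {ζ : Euc n → ℝ} (hv : MemLp v 2 (volume.restrict S))
    (hDv : MemLp Dv 2 (volume.restrict S)) (hζ : IsTest S ζ) :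
    (∫ x in S, v x • gradient ζ x = -∫ x in S, ζ x • Dv x) ↔
      ∀ a, ∫ x in S, v x * inner ℝ a (gradient ζ x) = -∫ x in S, ζ x * inner ℝ a (Dv x) := by
  have h1 : Integrable (fun x => v x • gradient ζ x) (volume.restrict S) :=
    memLp_one_iff_integrable.1 ((hζ.memLp_gradient S).smul hv)
  have h2 : Integrable (fun x => ζ x • Dv x) (volume.restrict S) :=
    memLp_one_iff_integrable.1 (hDv.smul (hζ.memLp S))
  have e1 (a : Euc n) : ∫ x in S, v x * inner ℝ a (gradient ζ x) =
      inner ℝ a (∫ x in S, v x • gradient ζ x) := by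
    rw [← integral_inner h1]
    simp only [inner_smul_right]
  have e2 (a : Euc n) : -∫ x in S, ζ x * inner ℝ a (Dv x) =
      inner ℝ a (-∫ x in S, ζ x • Dv x) := by
    rw [inner_neg_right, ← integral_inner h2]
    simp only [inner_smul_right]
  simp only [e1, e2]
  exact ⟨fun h a => by rw [h], fun h => ext_inner_left ℝ h⟩

/-- Both sides of the integration by parts formula are `L²`-continuous, so the formula passes from
smooth approximants to the limit. -/
theorem IsH1.of_tendsto {η : ℕ → Euc n → ℝ} (hv : MemLp v 2 (volume.restrict S))
    (hDv : MemLp Dv 2 (volume.restrict S)) (hη : ∀ k, IsTest T (η k))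
    (h : TendstoH1 S η v Dv) : IsH1 S v Dv := by
  refine ⟨hv, hDv, fun ζ hζ => (integral_smul_gradient_eq_iff hv hDv hζ).2 fun a => ?_⟩
  have h1 := tendsto_integral_mul (fun k => (hη k).memLp S) hv
    (memLp_inner_left (hζ.memLp_gradient S) a) h.1
  have hm : MemLp (fun x => ζ x • a) 2 (volume.restrict S) :=
    (ContinuousLinearMap.toSpanSingleton ℝ a).comp_memLp' (hζ.memLp S)
  have h2 := tendsto_integral_inner (fun k => (hη k).memLp_gradient S) hDv hm h.2
  have e (k : ℕ) : ∫ x in S, inner ℝ a (gradient ζ x) * η k x =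
      -∫ x in S, inner ℝ (gradient (η k) x) (ζ x • a) := by
    have := (hη k).integral_mul_gradient hζ a
    simp only [inner_smul_right, real_inner_comm a]
    simpa only [mul_comm, real_inner_comm a] using this
  have h3 := tendsto_nhds_unique (h1.congr e) h2.neg
  simp only [inner_smul_right, real_inner_comm a] at h3
  simpa only [mul_comm, real_inner_comm a] using h3

theorem TendstoH1.const {η : Euc n → ℝ} : TendstoH1 S (fun _ => η) η (gradient η) := by
  constructor <;> simp

theorem IsTest.isH10 {η : Euc n → ℝ} (hη : IsTest S η) : IsH10 S η (gradient η) :=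
  ⟨IsH1.of_tendsto (hη.memLp S) (hη.memLp_gradient S) (fun _ => hη) .const, fun _ => η,
    fun _ => hη, .const⟩

theorem TendstoH1.add_smul {η ζ : ℕ → Euc n → ℝ} (hv : IsH1 S v Dv) (hw : IsH1 S w Dw)
    (hη : ∀ k, IsTest T (η k)) (hζ : ∀ k, IsTest T (ζ k)) (h1 : TendstoH1 S η v Dv)
    (h2 : TendstoH1 S ζ w Dw) (c : ℝ) :
    TendstoH1 S (fun k x => η k x + c * ζ k x) (fun x => v x + c * w x)
      (fun x => Dv x + c • Dw x) := by
  constructor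
  · exact tendsto_eLpNorm_add_smul c (fun k => (((hη k).memLp S).sub hv.memLp).1)
      (fun k => (((hζ k).memLp S).sub hw.memLp).1) h1.1 h2.1
  · simp only [gradient_add_smul (hη _).differentiable (hζ _).differentiable]
    exact tendsto_eLpNorm_add_smul c (fun k => (((hη k).memLp_gradient S).sub hv.memLp_grad).1)
      (fun k => (((hζ k).memLp_gradient S).sub hw.memLp_grad).1) h1.2 h2.2

theorem IsH1.add_smul (hv : IsH1 S v Dv) (hw : IsH1 S w Dw) (c : ℝ) :
    IsH1 S (fun x => v x + c * w x) (fun x => Dv x + c • Dw x) := by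
  have hm : MemLp (fun x => v x + c * w x) 2 (volume.restrict S) :=
    hv.memLp.add (hw.memLp.const_mul c)
  have hmD : MemLp (fun x => Dv x + c • Dw x) 2 (volume.restrict S) :=
    hv.memLp_grad.add (hw.memLp_grad.const_smul c)
  refine ⟨hm, hmD, fun ζ hζ => (integral_smul_gradient_eq_iff hm hmD hζ).2 fun a => ?_⟩
  have e1 := (integral_smul_gradient_eq_iff hv.memLp hv.memLp_grad hζ).1 (hv.weak ζ hζ) a
  have e2 := (integral_smul_gradient_eq_iff hw.memLp hw.memLp_grad hζ).1 (hw.weak ζ hζ) a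
  have i1 := integrable_mul_of_memLp hv.memLp (memLp_inner_left (hζ.memLp_gradient S) a)
  have i2 := integrable_mul_of_memLp hw.memLp (memLp_inner_left (hζ.memLp_gradient S) a)
  have i3 := integrable_mul_of_memLp (hζ.memLp S) (memLp_inner_left hv.memLp_grad a)
  have i4 := integrable_mul_of_memLp (hζ.memLp S) (memLp_inner_left hw.memLp_grad a)
  simp only [inner_add_right, inner_smul_right, add_mul, mul_add, mul_assoc, mul_left_comm _ c]
  rw [integral_add i1 (i2.const_mul c), integral_add i3 (i4.const_mul c), integral_const_mul,
    integral_const_mul, e1, e2]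
  ring

theorem IsH10.add_smul (hv : IsH10 S v Dv) (hw : IsH10 S w Dw) (c : ℝ) :
    IsH10 S (fun x => v x + c * w x) (fun x => Dv x + c • Dw x) := by
  obtain ⟨hv1, η, hη, hηv⟩ := hv
  obtain ⟨hw1, ζ, hζ, hζw⟩ := hw
  exact ⟨hv1.add_smul hw1 c, _, fun k => (hη k).add_smul (hζ k) c,
    hηv.add_smul hv1 hw1 hη hζ hζw c⟩

theorem IsTrace.add_smul {Ω M : Set (Euc n)} {g h : Euc n → ℝ} (hv : IsH1 Ω v Dv)
    (hw : IsH1 Ω w Dw) (hg : IsTrace Ω M v Dv g) (hh : IsTrace Ω M w Dw h) (c : ℝ) :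
    IsTrace Ω M (fun x => v x + c * w x) (fun x => Dv x + c • Dw x) (fun x => g x + c * h x) := by
  obtain ⟨hgm, η, hη, hηv, hηg⟩ := hg
  obtain ⟨hhm, ζ, hζ, hζw, hζh⟩ := hh
  refine ⟨hgm.add (hhm.const_mul c), _, fun k => (hη k).add_smul (hζ k) c,
    hηv.add_smul hv hw hη hζ hζw c, ?_⟩
  exact tendsto_eLpNorm_add_smul c
    (fun k => (hη k).smooth.continuous.aestronglyMeasurable.sub hgm.1)
    (fun k => (hζ k).smooth.continuous.aestronglyMeasurable.sub hhm.1) hηg hζh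

theorem IsTest.isTrace {Ω Ωp Ωm M : Set (Euc n)} {η : Euc n → ℝ} (hn : 1 ≤ n)
    (h : IsDividedDomain Ω Ωp Ωm M) (hη : IsTest Ω η) : IsTrace Ω M η (gradient η) η :=
  ⟨hη.memLp_surf hn h, fun _ => η, fun _ => hη.mono (Set.subset_univ _), .const, by simp⟩

theorem tendsto_eLpNorm_zero_of_bound {F G : Type*} [NormedAddCommGroup F] [NormedAddCommGroup G]
    {ν : Measure (Euc n)} {f : ℕ → Euc n → F} {g : ℕ → Euc n → G} {C : ℝ}
    (hfg : ∀ k x, ‖f k x‖ ≤ C * ‖g k x‖) (h : Tendsto (fun k => eLpNorm (g k) 2 ν) atTop (𝓝 0)) :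
    Tendsto (fun k => eLpNorm (f k) 2 ν) atTop (𝓝 0) := by
  have h2 : Tendsto (fun k => ENNReal.ofReal C * eLpNorm (g k) 2 ν) atTop (𝓝 0) := by
    simpa using ENNReal.Tendsto.const_mul (a := ENNReal.ofReal C) h (Or.inr ENNReal.ofReal_ne_top)
  exact tendsto_of_tendsto_of_tendsto_of_le_of_le tendsto_const_nhds h2 (fun _ => zero_le)
    fun k => eLpNorm_le_mul_eLpNorm_of_ae_le_mul (.of_forall (hfg k)) 2

/-- Multiplication by a test function makes a function with a trace an element of `H¹₀`. -/
theorem IsTrace.test_mul {Ω M : Set (Euc n)} {g ζ : Euc n → ℝ} (hζ : IsTest Ω ζ)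
    (hv : IsH1 Ω v Dv) (hg : IsTrace Ω M v Dv g) :
    IsH10 Ω (fun x => ζ x * v x) (fun x => ζ x • Dv x + v x • gradient ζ x) ∧
    IsTrace Ω M (fun x => ζ x * v x) (fun x => ζ x • Dv x + v x • gradient ζ x)
      (fun x => ζ x * g x) := by
  obtain ⟨hgm, η, hη, hηv, hηg⟩ := hg
  obtain ⟨C, hC0, hC, hC'⟩ := hζ.exists_bound
  have hζη (k : ℕ) : IsTest Ω (fun x => ζ x * η k x) := hζ.mul (hη k).smooth
  have hcont := hζ.smooth.continuous
  have hcont' := hζ.continuous_gradient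
  have m1 : MemLp (fun x => ζ x * v x) 2 (volume.restrict Ω) :=
    hv.memLp.of_le_mul (c := C) (hcont.aestronglyMeasurable.mul hv.memLp.1)
      (.of_forall fun x => by rw [norm_mul]; gcongr; exact hC x)
  have m2 : MemLp (fun x => ζ x • Dv x) 2 (volume.restrict Ω) :=
    hv.memLp_grad.of_le_mul (c := C) (hcont.aestronglyMeasurable.smul hv.memLp_grad.1)
      (.of_forall fun x => by rw [norm_smul]; gcongr; exact hC x)
  have m3 : MemLp (fun x => v x • gradient ζ x) 2 (volume.restrict Ω) :=
    hv.memLp.of_le_mul (c := C) (hv.memLp.1.smul hcont'.aestronglyMeasurable)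
      (.of_forall fun x => by rw [norm_smul, mul_comm]; gcongr; exact hC' x)
  have m4 : MemLp (fun x => ζ x * g x) 2 (surf Ω M) :=
    hgm.of_le_mul (c := C) (hcont.aestronglyMeasurable.mul hgm.1)
      (.of_forall fun x => by rw [norm_mul]; gcongr; exact hC x)
  have ht : TendstoH1 Ω (fun k x => ζ x * η k x) (fun x => ζ x * v x)
      (fun x => ζ x • Dv x + v x • gradient ζ x) := by
    constructor
    · refine tendsto_eLpNorm_zero_of_bound (C := C) (fun k x => ?_) hηv.1
      rw [← mul_sub, norm_mul]
      gcongr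
      exact hC x
    · have t1 : Tendsto (fun k => eLpNorm (fun x => ζ x • gradient (η k) x - ζ x • Dv x) 2
          (volume.restrict Ω)) atTop (𝓝 0) := by
        refine tendsto_eLpNorm_zero_of_bound (C := C) (fun k x => ?_) hηv.2
        rw [← smul_sub, norm_smul]
        gcongr
        exact hC x
      have t2 : Tendsto (fun k => eLpNorm (fun x => η k x • gradient ζ x - v x • gradient ζ x) 2
          (volume.restrict Ω)) atTop (𝓝 0) := by
        refine tendsto_eLpNorm_zero_of_bound (C := C) (fun k x => ?_) hηv.1
        rw [← sub_smul, norm_smul, mul_comm]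
        gcongr
        exact hC' x
      have := tendsto_eLpNorm_add_smul 1 (fun k => (hcont.aestronglyMeasurable.smul
          (hη k).continuous_gradient.aestronglyMeasurable).sub m2.1)
        (fun k => ((hη k).smooth.continuous.aestronglyMeasurable.smul
          hcont'.aestronglyMeasurable).sub m3.1) t1 t2
      simpa only [gradient_mul hζ.differentiable (hη _).differentiable, one_smul,
        Pi.smul_apply'] using this
  refine ⟨⟨IsH1.of_tendsto m1 (m2.add m3) hζη ht, _, hζη, ht⟩, m4, _,
    fun k => (hζη k).mono (Set.subset_univ _), ht, ?_⟩
  refine tendsto_eLpNorm_zero_of_bound (C := C) (fun k x => ?_) hηg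
  rw [← mul_sub, norm_mul]
  gcongr
  exact hC x

end Sobolev

end ThinObstacle
namespace ThinObstacle

/-! ### The integrand on the hypersurface -/

section Rho

variable {C c t j : ℝ}

theorem cBeta_pos {β₁ β₂ : ℝ} (h₁ : 0 < β₁) (h₂ : 0 < β₂) : 0 < cBeta β₁ β₂ := by
  unfold cBeta
  positivity

/-- The optimal splitting of `j` behind the definition of `rho`. -/
theorem rho_eq (hC : 0 < C) (hc : 0 < c) :
    rho C c t j = 2 * ((j - min j (c / C ^ 2 * t)) * t) +
      C ^ 2 / c * (min j (c / C ^ 2 * t) * min j (c / C ^ 2 * t)) := by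
  unfold rho
  split_ifs with h
  · have := hc.ne'
    rw [min_eq_right h]
    field_simp
    ring
  · rw [min_eq_left (not_le.1 h).le]
    ring

theorem rho_nonneg (hC : 0 < C) (hc : 0 < c) (ht : 0 ≤ t) : 0 ≤ rho C c t j := by
  rw [rho_eq hC hc]
  have h1 : 0 ≤ j - min j (c / C ^ 2 * t) := sub_nonneg.2 (min_le_left _ _)
  have h2 := mul_self_nonneg (min j (c / C ^ 2 * t))
  positivity

/-- The bound does not involve `t`: where `t` enters, the case condition bounds it by a multiple of
`j`. Hence `ρ` is integrable even though `ψ` is not known to be in `L²(M)`. -/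
theorem rho_le (hC : 0 < C) (hc : 0 < c) (ht : 0 ≤ t) :
    rho C c t j ≤ 2 * (C ^ 2 / c) * (j * j) := by
  unfold rho
  have hk : 0 < C ^ 2 / c := by positivity
  split_ifs with h
  · have h0 : 0 ≤ c / C ^ 2 * t := by positivity
    have h1 : t ≤ C ^ 2 / c * j := by
      calc t = C ^ 2 / c * (c / C ^ 2 * t) := by field_simp
        _ ≤ _ := by gcongr
    have h2 : 0 ≤ t * (c / C ^ 2 * t) := mul_nonneg ht h0
    have h3 : t * j ≤ C ^ 2 / c * j * j := mul_le_mul_of_nonneg_right h1 (h0.trans h)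
    nlinarith
  · nlinarith [mul_nonneg hk.le (mul_self_nonneg j)]

theorem rho_eq_zero (hC : 0 < C) (hc : 0 < c) (ht : 0 ≤ t) (hj : 0 ≤ j) (htj : j * t = 0) :
    rho C c t j = 0 := by
  rcases mul_eq_zero.1 htj with rfl | rfl
  · have h0 : 0 ≤ c / C ^ 2 * t := by positivity
    rw [rho_eq hC hc, min_eq_left h0]
    ring
  · simp [rho, hj]

theorem abs_min_le (hC : 0 < C) (hc : 0 < c) (ht : 0 ≤ t) : |min j (c / C ^ 2 * t)| ≤ |j| := by
  have h0 : 0 ≤ c / C ^ 2 * t := by positivity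
  rcases le_total j (c / C ^ 2 * t) with h | h
  · rw [min_eq_left h]
  · rw [min_eq_right h, abs_of_nonneg h0]
    exact h.trans (le_abs_self j)

end Rho

/-! ### Young's inequality with two parameters -/

section Young

/-- Young's inequality is applied first to `A + (B + D)`, then to `B + D`. The coefficient of `D²`
is `(1 + β₁⁻¹)(1 + β₂⁻¹)`, the reciprocal of `c_β`. -/
theorem sq_add_add_le {β₁ β₂ : ℝ} (h₁ : 0 < β₁) (h₂ : 0 < β₂) (A B D : ℝ) :
    (A + B + D) ^ 2 ≤ (1 + β₁) * A ^ 2 + (1 + β₁⁻¹) * (1 + β₂) * B ^ 2 +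
      D ^ 2 / cBeta β₁ β₂ := by
  have e : D ^ 2 / cBeta β₁ β₂ = (1 + β₁⁻¹) * (1 + β₂⁻¹) * D ^ 2 := by
    unfold cBeta
    field_simp
    ring
  have young {β : ℝ} (h : 0 < β) (X Y : ℝ) :
      (X + Y) ^ 2 ≤ (1 + β) * X ^ 2 + (1 + β⁻¹) * Y ^ 2 := by
    have h3 : (1 + β) * X ^ 2 + (1 + β⁻¹) * Y ^ 2 - (X + Y) ^ 2 = β⁻¹ * (β * X - Y) ^ 2 := by
      field_simp
      ring
    have : 0 ≤ β⁻¹ * (β * X - Y) ^ 2 := by positivity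
    linarith
  rw [e]
  calc (A + B + D) ^ 2 = (A + (B + D)) ^ 2 := by ring
    _ ≤ (1 + β₁) * A ^ 2 + (1 + β₁⁻¹) * (B + D) ^ 2 := young h₁ _ _
    _ ≤ (1 + β₁) * A ^ 2 + (1 + β₁⁻¹) * ((1 + β₂) * B ^ 2 + (1 + β₂⁻¹) * D ^ 2) := by
        gcongr
        exact young h₂ _ _
    _ = _ := by ring

end Young

/-! ### Admissible functions, the variational inequality and Green's formula -/

section Trace

variable {n : ℕ} {Ω Ωp Ωm M : Set (Euc n)} {u v w φ : Euc n → ℝ} {Du Dv Dw Dφ : Euc n → Euc n}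
  {ψ g h : Euc n → ℝ}

theorem IsH10.sub {S : Set (Euc n)} (hv : IsH10 S v Dv) (hw : IsH10 S w Dw) :
    IsH10 S (fun x => v x - w x) (fun x => Dv x - Dw x) := by
  simpa [sub_eq_add_neg] using hv.add_smul hw (-1)

theorem IsTrace.sub (hv : IsH1 Ω v Dv) (hw : IsH1 Ω w Dw) (hg : IsTrace Ω M v Dv g)
    (hh : IsTrace Ω M w Dw h) :
    IsTrace Ω M (fun x => v x - w x) (fun x => Dv x - Dw x) (fun x => g x - h x) := by
  simpa [sub_eq_add_neg] using hg.add_smul hv hw hh (-1)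

/-- The difference of two admissible functions belongs to `H¹₀`. -/
theorem IsAdmissible.sub (hv : IsAdmissible Ω M φ Dφ ψ v Dv) (hu : IsAdmissible Ω M φ Dφ ψ u Du) :
    IsH10 Ω (fun x => v x - u x) (fun x => Dv x - Du x) := by
  simpa using hv.2.1.sub hu.2.1

/-- Applied to differences, this yields uniqueness of traces directly from the trace inequality. -/
theorem IsTrace.ae_eq_zero {S : Set (Euc n)} {C : ℝ} (hC : IsTraceConst Ω M S C) (hS : S ⊆ Ω)
    (hw : IsH10 Ω w Dw) (hh : IsTrace Ω M w Dw h) (hD : Dw =ᵐ[volume.restrict Ω] 0) :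
    h =ᵐ[surf Ω M] 0 := by
  refine ae_eq_zero_of_l2norm_eq_zero hh.1 (le_antisymm ?_ (l2norm_nonneg _ _))
  have := hC.2 w Dw h hw hh
  rwa [l2norm_eq_zero_of_ae_eq_zero (ae_mono (Measure.restrict_mono hS le_rfl) hD), mul_zero]
    at this

/-- Admissibility only provides some trace above `ψ`; uniqueness transfers the inequality to any
given one. -/
theorem IsAdmissible.le_trace {S : Set (Euc n)} {C : ℝ} (hC : IsTraceConst Ω M S C) (hS : S ⊆ Ω)
    (hv : IsAdmissible Ω M φ Dφ ψ v Dv) (hg : IsTrace Ω M v Dv g) :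
    ∀ᵐ x ∂(surf Ω M), ψ x ≤ g x := by
  have h0 := hv.sub hv
  obtain ⟨hv1, -, g', hg', hle⟩ := hv
  have := (IsTrace.sub hv1 hv1 hg hg').ae_eq_zero hC hS h0 (.of_forall fun x => by simp)
  filter_upwards [this, hle] with x h1 h2
  simp only [Pi.zero_apply] at h1
  linarith

theorem IsAdmissible.add (hu : IsAdmissible Ω M φ Dφ ψ u Du) (hg : IsTrace Ω M u Du g)
    (hw : IsH10 Ω w Dw) (hh : IsTrace Ω M w Dw h) (s : ℝ)
    (hle : ∀ᵐ x ∂(surf Ω M), ψ x ≤ g x + s * h x) :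
    IsAdmissible Ω M φ Dφ ψ (fun x => u x + s * w x) (fun x => Du x + s • Dw x) := by
  refine ⟨hu.1.add_smul hw.1 s, ?_, _, hg.add_smul hu.1 hw.1 hh s, hle⟩
  have := hu.2.1.add_smul hw s
  have e1 : (fun x => u x + s * w x - φ x) = fun x => u x - φ x + s * w x :=
    funext fun x => add_sub_right_comm _ _ _
  have e2 : (fun x => Du x + s • Dw x - Dφ x) = fun x => Du x - Dφ x + s • Dw x :=
    funext fun x => add_sub_right_comm _ _ _
  rwa [e1, e2]

/-- The variational inequality. -/
theorem IsMinimizer.integral_inner_nonneg (hu : IsMinimizer Ω M φ Dφ ψ u Du)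
    (hg : IsTrace Ω M u Du g) (hψ : ∀ᵐ x ∂(surf Ω M), ψ x ≤ g x) (hw : IsH10 Ω w Dw)
    (hh : IsTrace Ω M w Dw h) (hle : ∀ᵐ x ∂(surf Ω M), ψ x ≤ g x + h x) :
    0 ≤ ∫ x in Ω, inner ℝ (Du x) (Dw x) := by
  have hDu := hu.1.1.memLp_grad
  have hDw := hw.1.memLp_grad
  set I := ∫ x in Ω, inner ℝ (Du x) (Dw x)
  set W := ∫ x in Ω, ‖Dw x‖ ^ 2
  have hW : 0 ≤ W := integral_nonneg fun x => by positivity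
  -- Compare the energies of `u` and `u + s w`: the difference is `s/2` times this expression.
  have key (s : ℝ) (hs0 : 0 < s) (hs1 : s ≤ 1) : 0 ≤ 2 * I + s * W := by
    have hadm := hu.1.add hg hw hh s (by
      filter_upwards [hψ, hle] with x h1 h2
      nlinarith)
    have hE := hu.2 _ _ hadm
    have e : ∫ x in Ω, ‖Du x + s • Dw x‖ ^ 2 = (∫ x in Ω, ‖Du x‖ ^ 2) + 2 * s * I + s ^ 2 * W := by
      have i1 : Integrable (fun x => ‖Du x‖ ^ 2) (volume.restrict Ω) := hDu.norm.integrable_sq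
      have i2 : Integrable (fun x => ‖Dw x‖ ^ 2) (volume.restrict Ω) := hDw.norm.integrable_sq
      have i3 := integrable_inner hDu hDw
      have i4 : Integrable (fun x => ‖Du x‖ ^ 2 + 2 * s * inner ℝ (Du x) (Dw x))
        (volume.restrict Ω) := i1.add (i3.const_mul _)
      rw [← integral_const_mul, ← integral_const_mul, ← integral_add i1 (i3.const_mul _),
        ← integral_add i4 (i2.const_mul _)]
      congr 1 with x
      rw [norm_add_sq_real, inner_smul_right, norm_smul, mul_pow, Real.norm_eq_abs, sq_abs]
      ring
    rw [energy, energy, e] at hE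
    have : 0 ≤ s * (2 * I + s * W) := by nlinarith
    exact nonneg_of_mul_nonneg_right this hs0
  by_contra! hI
  -- With this `s`, `s W ≤ -I`, hence `2I + sW ≤ I < 0`. The `+ 1` avoids division by zero.
  have h1 := key (min 1 (-I / (W + 1))) (lt_min one_pos (div_pos (by linarith) (by linarith)))
    (min_le_left _ _)
  have h2 : min 1 (-I / (W + 1)) * W ≤ -I / (W + 1) * (W + 1) :=
    mul_le_mul (min_le_right _ _) (by linarith) hW (div_nonneg (by linarith) (by linarith))
  rw [div_mul_cancel₀ _ (by linarith)] at h2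
  linarith

theorem IsDividedDomain.setIntegral_add (hgeom : IsDividedDomain Ω Ωp Ωm M) {f : Euc n → ℝ}
    (hf : IntegrableOn f Ω) : (∫ x in Ωp, f x) + ∫ x in Ωm, f x = ∫ x in Ω, f x := by
  rw [hgeom.restrict_eq, setIntegral_union hgeom.disjoint hgeom.domain_minus.isOpen.measurableSet
    (hf.mono_set hgeom.plus_subset) (hf.mono_set hgeom.minus_subset)]

/-- Green's formula for fields in `H(Ω_±, div)` and functions in `H¹₀`. -/
theorem IsHDiv.integral_inner_add (hn : 1 ≤ n) (hgeom : IsDividedDomain Ω Ωp Ωm M)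
    {C : ℝ} (hC : IsTraceConst Ω M Ωp C) {q : Euc n → Euc n} {d j : Euc n → ℝ}
    (hq : IsHDiv Ω Ωp Ωm M q d j) (hw : IsH10 Ω w Dw) (hh : IsTrace Ω M w Dw h) :
    (∫ x in Ω, inner ℝ (q x) (Dw x)) + ((∫ x in Ωp, d x * w x) + ∫ x in Ωm, d x * w x) =
      ∫ x, j x * h x ∂(surf Ω M) := by
  obtain ⟨η, hη, hηw⟩ := hw.2
  have hmono {S : Set (Euc n)} (hS : S ⊆ Ω) : volume.restrict S ≤ volume.restrict Ω :=
    Measure.restrict_mono hS le_rfl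
  have hsub {S : Set (Euc n)} (hS : S ⊆ Ω) :
      Tendsto (fun k => eLpNorm (fun x => η k x - w x) 2 (volume.restrict S)) atTop (𝓝 0) :=
    tendsto_of_tendsto_of_tendsto_of_le_of_le tendsto_const_nhds hηw.1 (fun _ => zero_le)
      fun k => eLpNorm_mono_measure _ (hmono hS)
  have t1 := tendsto_integral_inner (fun k => (hη k).memLp_gradient Ω) hw.1.memLp_grad hq.memLp
    hηw.2
  have t2 := tendsto_integral_mul (fun k => (hη k).memLp Ωp)
    (hw.1.memLp.mono_measure (hmono hgeom.plus_subset)) hq.div_plus.1 (hsub hgeom.plus_subset)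
  have t3 := tendsto_integral_mul (fun k => (hη k).memLp Ωm)
    (hw.1.memLp.mono_measure (hmono hgeom.minus_subset)) hq.div_minus.1 (hsub hgeom.minus_subset)
  -- The approximants from `H¹₀` need not be those from the definition of the trace `h`. The trace
  -- inequality for `η k - w` shows that they converge to `h` on `M` as well.
  have t4 : Tendsto (fun k => eLpNorm (fun x => η k x - h x) 2 (surf Ω M)) atTop (𝓝 0) := by
    have hm (k : ℕ) : MemLp (fun x => η k x - h x) 2 (surf Ω M) :=
      ((hη k).memLp_surf hn hgeom).sub hh.1
    rw [← ENNReal.tendsto_toReal_iff (fun k => (hm k).eLpNorm_ne_top) ENNReal.zero_ne_top]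
    have h1 := ((ENNReal.tendsto_toReal ENNReal.zero_ne_top).comp hηw.2).const_mul C
    rw [ENNReal.toReal_zero, mul_zero] at h1
    refine squeeze_zero (fun _ => ENNReal.toReal_nonneg) (fun k => ?_) h1
    refine (hC.2 _ _ _ ((hη k).isH10.sub hw)
      (IsTrace.sub (hη k).isH10.1 hw.1 ((hη k).isTrace hn hgeom) hh)).trans ?_
    exact mul_le_mul_of_nonneg_left (l2norm_mono (hmono hgeom.plus_subset)
      (((hη k).memLp_gradient Ω).sub hw.1.memLp_grad)) hC.1.le
  have t5 := tendsto_integral_mul (fun k => (hη k).memLp_surf hn hgeom) hh.1 hq.memLp_jump t4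
  have t6 := t1.add (t2.add t3)
  simp only [real_inner_comm (q _)] at t6
  refine tendsto_nhds_unique t6 (t5.congr fun k => ?_)
  rw [← hq.jump (η k) (hη k), normalTrace, normalTrace, ← hgeom.setIntegral_add
    (integrable_inner hq.memLp ((hη k).memLp_gradient Ω))]
  ring

theorem IsSmoothOn.continuousOn (hψ : IsSmoothOn M ψ) : ContinuousOn ψ M := by
  intro x hx
  obtain ⟨U, Ψ, hU, hxU, hΨ, h⟩ := hψ x hx
  have h1 : ContinuousWithinAt ψ (M ∩ U) x :=
    hΨ.continuous.continuousWithinAt.congr h (h x ⟨hx, hxU⟩)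
  exact (continuousWithinAt_inter (hU.mem_nhds hxU)).1 h1

theorem IsSmoothOn.aestronglyMeasurable (hgeom : IsDividedDomain Ω Ωp Ωm M)
    (hψ : IsSmoothOn M ψ) : AEStronglyMeasurable ψ (surf Ω M) :=
  (hψ.continuousOn.mono Set.inter_subset_left).aestronglyMeasurable hgeom.measurableSet_inter

end Trace

/-! ### The surface term and its splitting -/

section Majorant

variable {n : ℕ} {ν : Measure (Euc n)} {t j : Euc n → ℝ} {C c : ℝ}

theorem memLp_min (hC : 0 < C) (hc : 0 < c) (ht : ∀ᵐ x ∂ν, 0 ≤ t x)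
    (htm : AEStronglyMeasurable t ν) (hj : MemLp j 2 ν) :
    MemLp (fun x => min (j x) (c / C ^ 2 * t x)) 2 ν := by
  refine hj.mono (hj.1.inf (htm.const_mul _)) ?_
  filter_upwards [ht] with x hx
  exact abs_min_le hC hc hx

theorem integrable_rho (hC : 0 < C) (hc : 0 < c) (ht : ∀ᵐ x ∂ν, 0 ≤ t x)
    (htm : AEStronglyMeasurable t ν) (hj : MemLp j 2 ν) :
    Integrable (fun x => rho C c (t x) (j x)) ν := by
  refine ((integrable_mul_of_memLp hj hj).const_mul (2 * (C ^ 2 / c))).mono' ?_ ?_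
  · have hm := (memLp_min hC hc ht htm hj).1
    simp only [rho_eq hC hc]
    exact (((hj.1.sub hm).mul htm).const_mul 2).add ((hm.mul hm).const_mul _)
  · filter_upwards [ht] with x hx
    rw [Real.norm_eq_abs, abs_of_nonneg (rho_nonneg hC hc hx)]
    exact rho_le hC hc hx

/-- The estimate of the boundary term by `ρ`. -/
theorem two_mul_integral_mul_le (hC : 0 < C) (hc : 0 < c) (ht : ∀ᵐ x ∂ν, 0 ≤ t x)
    (htm : AEStronglyMeasurable t ν) (hj : MemLp j 2 ν) {h : Euc n → ℝ} (hh : MemLp h 2 ν)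
    (hht : ∀ᵐ x ∂ν, h x ≤ t x) {N : ℝ} (hN : l2norm ν h ≤ C * N) :
    ∃ D, 2 * ∫ x, j x * h x ∂ν ≤ 2 * (D * N) + (∫ x, rho C c (t x) (j x) ∂ν) - D ^ 2 / c := by
  set m : Euc n → ℝ := fun x => min (j x) (c / C ^ 2 * t x)
  have hm : MemLp m 2 ν := memLp_min hC hc ht htm hj
  have hρ := integrable_rho hC hc ht htm hj
  have i1 := integrable_mul_of_memLp hj hh
  have i2 := integrable_mul_of_memLp hm hh
  have i3 := integrable_mul_of_memLp hm hm
  have i4 : Integrable (fun x => 2 * (m x * h x) + rho C c (t x) (j x)) ν :=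
    (i2.const_mul 2).add hρ
  -- Since `j - m ≥ 0`, replacing `h` by `t` only increases `(j - m) h`; by `rho_eq`, `2(j - m)t = ρ
  -- - (C²/c) m²`.
  have h1 : ∫ x, 2 * (j x * h x) ∂ν ≤
      ∫ x, (2 * (m x * h x) + rho C c (t x) (j x)) - C ^ 2 / c * (m x * m x) ∂ν := by
    refine integral_mono_ae (i1.const_mul 2) (i4.sub (i3.const_mul _)) ?_
    filter_upwards [hht] with x hx
    simp only [rho_eq hC hc]
    have : (j x - m x) * h x ≤ (j x - m x) * t x :=
      mul_le_mul_of_nonneg_left hx (sub_nonneg.2 (min_le_left _ _))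
    change _ ≤ 2 * (m x * h x) + (2 * ((j x - m x) * t x) + C ^ 2 / c * (m x * m x)) - _
    linarith
  rw [integral_sub i4 (i3.const_mul _), integral_add (i2.const_mul 2) hρ,
    integral_const_mul, integral_const_mul, integral_const_mul] at h1
  have e : ∫ x, m x * m x ∂ν = l2norm ν m ^ 2 := by
    rw [l2norm_sq hm]
    congr 1 with x
    rw [Real.norm_eq_abs, sq_abs, sq]
  have h2 : ∫ x, m x * h x ∂ν ≤ l2norm ν m * (C * N) :=
    (le_abs_self _).trans ((abs_integral_mul_le hm hh).trans
      (mul_le_mul_of_nonneg_left hN (l2norm_nonneg _ _)))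
  refine ⟨C * l2norm ν m, ?_⟩
  rw [e] at h1
  have e2 : (C * l2norm ν m) ^ 2 / c = C ^ 2 / c * l2norm ν m ^ 2 := by ring
  rw [e2]
  linarith

end Majorant

end ThinObstacle
namespace ThinObstacle

/-! ### Fundamental lemmas of the calculus of variations -/

section Fundamental

variable {n : ℕ} {Ω : Set (Euc n)} {ν : Measure (Euc n)}

/-- The fundamental lemma of the calculus of variations, for inequalities. -/
theorem ae_nonneg_of_integral_test_nonneg (hΩ : IsOpen Ω) (hνΩ : ∀ᵐ x ∂ν, x ∈ Ω)
    (hν : ∀ η, IsTest Ω η → MemLp η 2 ν) {j : Euc n → ℝ} (hj : MemLp j 2 ν)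
    (h : ∀ η, IsTest Ω η → (∀ x, 0 ≤ η x) → 0 ≤ ∫ x, j x * η x ∂ν) : ∀ᵐ x ∂ν, 0 ≤ j x := by
  -- The cutoff equals `1` exactly on `K`, so its powers decrease pointwise to the indicator of `K`.
  have hcut {K s : Set (Euc n)} (hK : IsCompact K) (hs : IsOpen s) (hKs : K ⊆ s)
      (hsΩ : closure s ⊆ Ω) (hsc : IsCompact (closure s)) :
      ∃ f : Euc n → ℝ, IsTest Ω f ∧ (∀ x, f x ∈ Set.Icc (0 : ℝ) 1) ∧ ∀ x, x ∈ K ↔ f x = 1 := by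
    obtain ⟨f, hf, hr, hsupp, h1⟩ := exists_contMDiff_support_eq_eq_one_iff
      (modelWithCornersSelf ℝ (Euc n)) (n := ⊤) hs hK.isClosed hKs
    have ht : tsupport f = closure s := by rw [tsupport, hsupp]
    exact ⟨f, ⟨hf.contDiff, by rwa [HasCompactSupport, ht], by rwa [ht]⟩,
      fun x => hr (Set.mem_range_self x), h1⟩
  have hcompact {K : Set (Euc n)} (hK : IsCompact K) (hKΩ : K ⊆ Ω) :
      0 ≤ ∫ x in K, j x ∂ν ∧ IntegrableOn j K ν := by
    obtain ⟨s, hs, hKs, hsΩ, hsc⟩ := exists_open_between_and_isCompact_closure hK hΩ hKΩ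
    obtain ⟨f, hf, hf01, hfK⟩ := hcut hK hs hKs hsΩ hsc
    have hjf := integrable_mul_of_memLp hj (hν f hf)
    have hpow (k : ℕ) : IsTest Ω (fun x => f x ^ (k + 1)) := by
      have := hf.mul (hf.smooth.pow k)
      simpa only [pow_succ'] using this
    have hlim : Tendsto (fun k : ℕ => ∫ x, j x * f x ^ (k + 1) ∂ν) atTop
        (𝓝 (∫ x, K.indicator j x ∂ν)) := by
      refine tendsto_integral_of_dominated_convergence (fun x => ‖j x * f x‖)
        (fun k => hj.1.mul (hpow k).smooth.continuous.aestronglyMeasurable) hjf.norm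
        (fun k => .of_forall fun x => ?_) (.of_forall fun x => ?_)
      · rw [norm_mul, norm_mul, norm_pow]
        have h0 : ‖f x‖ ≤ 1 := by
          rw [Real.norm_eq_abs, abs_of_nonneg (hf01 x).1]
          exact (hf01 x).2
        exact mul_le_mul_of_nonneg_left
          (pow_le_of_le_one (norm_nonneg _) h0 (Nat.succ_ne_zero k)) (norm_nonneg _)
      · by_cases hx : x ∈ K
        · simp [(hfK x).1 hx, hx]
        · have h1 : f x < 1 := lt_of_le_of_ne (hf01 x).2 fun h' => hx ((hfK x).2 h')
          have := (tendsto_pow_atTop_nhds_zero_of_lt_one (hf01 x).1 h1).comp (tendsto_add_atTop_nat 1)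
          simpa [hx] using this.const_mul (j x)
    refine ⟨?_, ?_⟩
    · rw [← integral_indicator hK.measurableSet]
      exact ge_of_tendsto' hlim fun k => h _ (hpow k) fun x => pow_nonneg (hf01 x).1 _
    · refine hjf.integrableOn.congr_fun (fun x hx => ?_) hK.measurableSet
      simp [(hfK x).1 hx]
  -- Finiteness on compact sets comes from `hν`: a cutoff equal to `1` on `K` is square integrable.
  have hfin {K : Set (Euc n)} (hK : IsCompact K) (hKΩ : K ⊆ Ω) : ν K < ⊤ := by
    obtain ⟨s, hs, hKs, hsΩ, hsc⟩ := exists_open_between_and_isCompact_closure hK hΩ hKΩ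
    obtain ⟨f, hf, hf01, hfK⟩ := hcut hK hs hKs hsΩ hsc
    have hff := integrable_mul_of_memLp (hν f hf) (hν f hf)
    have : IntegrableOn (fun _ => (1 : ℝ)) K ν :=
      hff.integrableOn.congr_fun (fun x hx => by simp [(hfK x).1 hx]) hK.measurableSet
    simpa [integrableOn_const_iff] using this
  have hloc : ν {x | ¬ (x ∈ Ω → 0 ≤ j x)} = 0 := by
    refine measure_null_of_locally_null _ fun x hx => ?_
    have hxΩ : x ∈ Ω := by
      by_contra h'
      exact hx fun h'' => absurd h'' h'
    obtain ⟨r, hr, hrΩ⟩ := Metric.nhds_basis_closedBall.mem_iff.1 (hΩ.mem_nhds hxΩ)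
    refine ⟨_, inter_mem_nhdsWithin _ (Metric.closedBall_mem_nhds x hr), ?_⟩
    set B := Metric.closedBall x r
    have hB : IsCompact B := isCompact_closedBall x r
    have hBfin : IsFiniteMeasure (ν.restrict B) := ⟨by simpa using hfin hB hrΩ⟩
    have hA : NullMeasurableSet {y | j y < 0} ν := nullMeasurableSet_lt hj.1.aemeasurable
      aemeasurable_const
    obtain ⟨t, htA, htm, hteq⟩ := (hA.mono_ac
      (Measure.restrict_le_self (s := B)).absolutelyContinuous).exists_measurable_subset_ae_eq
    -- If `t` had positive measure, inner regularity of the finite measure `ν.restrict B` would give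
    -- a compact `K` of positive measure on which `j < 0`, contradicting the nonnegative integral
    -- over `K`.
    have ht0 : ν.restrict B t = 0 := by
      by_contra hne
      obtain ⟨K, hKt, hK, hKpos⟩ := (htm.inter hB.measurableSet).exists_lt_isCompact
        (μ := ν.restrict B) (r := 0) (by
          rw [Measure.restrict_apply (htm.inter hB.measurableSet), Set.inter_assoc,
            Set.inter_self, ← Measure.restrict_apply htm]
          exact pos_iff_ne_zero.2 hne)
      have hKB : K ⊆ B := hKt.trans Set.inter_subset_right
      obtain ⟨h1, h2⟩ := hcompact hK (hKB.trans hrΩ)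
      have hneg : ∀ᵐ y ∂ν.restrict K, j y < 0 :=
        (ae_restrict_mem hK.measurableSet).mono fun y hy => htA (hKt hy).1
      have hpos : 0 ≤ᵐ[ν.restrict K] fun y => -j y := by
        filter_upwards [hneg] with y hy
        exact neg_nonneg.2 hy.le
      have h3 : ∫ y in K, -j y ∂ν = 0 := by
        refine le_antisymm ?_ (integral_nonneg_of_ae hpos)
        rw [integral_neg]
        linarith
      rw [integral_eq_zero_iff_of_nonneg_ae hpos h2.neg] at h3
      have h4 : ∀ᵐ y ∂ν.restrict K, False := by
        filter_upwards [hneg, h3] with y h5 h6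
        simp only [Pi.zero_apply] at h6
        linarith
      rw [eventually_false_iff_eq_bot, ae_eq_bot, Measure.restrict_eq_zero] at h4
      exact hKpos.ne' (le_antisymm ((Measure.restrict_le_self K).trans h4.le) zero_le)
    have h5 : ν.restrict B {y | j y < 0} = 0 := (measure_congr hteq).symm.trans ht0
    rw [Measure.restrict_apply' hB.measurableSet] at h5
    refine measure_mono_null (Set.inter_subset_inter_left B fun y hy => ?_) h5
    simp only [Set.mem_ofPred_eq, not_forall, not_le] at hy ⊢
    exact hy.2
  filter_upwards [hνΩ, ae_iff.2 hloc] with x h1 h2 using h2 h1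

/-- The weak gradient is unique. -/
theorem IsH1.ae_eq {v u : Euc n → ℝ} {Dv Du : Euc n → Euc n} (hΩ : IsOpen Ω) (hv : IsH1 Ω v Dv)
    (hu : IsH1 Ω u Du) (h : v =ᵐ[volume.restrict Ω] u) : Dv =ᵐ[volume.restrict Ω] Du := by
  have hm := hv.memLp_grad.sub hu.memLp_grad
  have := hΩ.ae_eq_zero_of_integral_contDiff_smul_eq_zero (μ := volume.restrict Ω) (f := Dv - Du)
    ((hm.locallyIntegrable (by norm_num)).locallyIntegrableOn Ω) (fun η h1 h2 h3 => by
      have hη : IsTest Ω η := ⟨h1, h2, h3⟩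
      have i1 : Integrable (fun x => η x • Dv x) (volume.restrict Ω) :=
        memLp_one_iff_integrable.1 (hv.memLp_grad.smul (hη.memLp Ω))
      have i2 : Integrable (fun x => η x • Du x) (volume.restrict Ω) :=
        memLp_one_iff_integrable.1 (hu.memLp_grad.smul (hη.memLp Ω))
      simp only [Pi.sub_apply, smul_sub]
      rw [integral_sub i1 i2, sub_eq_zero, ← neg_inj, ← hv.weak η hη, ← hu.weak η hη]
      refine integral_congr_ae ?_
      filter_upwards [h] with x hx
      rw [hx])
  filter_upwards [this, ae_restrict_mem hΩ.measurableSet] with x h1 h2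
  exact sub_eq_zero.1 (h1 h2)

end Fundamental

/-! ### Optimality conditions for the minimizer -/

section Minimizer

variable {n : ℕ} {Ω Ωp Ωm M : Set (Euc n)} {u φ : Euc n → ℝ} {Du Dφ : Euc n → Euc n}
  {ψ g : Euc n → ℝ}

theorem ae_surf_mem (hgeom : IsDividedDomain Ω Ωp Ωm M) : ∀ᵐ x ∂(surf Ω M), x ∈ M ∩ Ω :=
  ae_restrict_mem hgeom.measurableSet_inter

theorem IsMinimizer.integral_inner_gradient_nonneg (hn : 1 ≤ n)
    (hgeom : IsDividedDomain Ω Ωp Ωm M) (hu : IsMinimizer Ω M φ Dφ ψ u Du)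
    (hg : IsTrace Ω M u Du g) (hψ : ∀ᵐ x ∂(surf Ω M), ψ x ≤ g x) {η : Euc n → ℝ}
    (hη : IsTest Ω η) (hη0 : ∀ x ∈ M, 0 ≤ η x) :
    0 ≤ ∫ x in Ω, inner ℝ (Du x) (gradient η x) := by
  refine hu.integral_inner_nonneg hg hψ hη.isH10 (hη.isTrace hn hgeom) ?_
  filter_upwards [hψ, ae_surf_mem hgeom] with x h1 h2
  have := hη0 x h2.1
  linarith

/-- A minimizer is harmonic away from the obstacle. -/
theorem IsMinimizer.ae_div_eq_zero (hn : 1 ≤ n) (hgeom : IsDividedDomain Ω Ωp Ωm M)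
    (hu : IsMinimizer Ω M φ Dφ ψ u Du) (hg : IsTrace Ω M u Du g)
    (hψ : ∀ᵐ x ∂(surf Ω M), ψ x ≤ g x) {S : Set (Euc n)} (hS : IsOpen S) (hSΩ : S ⊆ Ω \ M)
    {q : Euc n → Euc n} {d : Euc n → ℝ} (hd : IsWeakDiv S q d)
    (hq : q =ᵐ[volume.restrict Ω] Du) : d =ᵐ[volume.restrict S] 0 := by
  have hSΩ' : S ⊆ Ω := fun x hx => (hSΩ hx).1
  have hM {x : Euc n} (hx : x ∈ M) : x ∉ S := fun h => (hSΩ h).2 hx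
  have := hS.ae_eq_zero_of_integral_contDiff_smul_eq_zero (μ := volume.restrict S) (f := d)
    ((hd.1.locallyIntegrable (by norm_num)).locallyIntegrableOn S) (fun η h1 h2 h3 => by
      have hη : IsTest S η := ⟨h1, h2, h3⟩
      -- This is `-η`, written so that `IsTest.add_smul` applies. As `η` vanishes on `M`, both signs
      -- are admissible variations, which turns the inequality into an equality.
      have hη' : IsTest S (fun x => η x + (-2) * η x) := hη.add_smul hη (-2)
      have e1 := hu.integral_inner_gradient_nonneg hn hgeom hg hψ (hη.mono hSΩ')
        fun x hx => (hη.eq_zero (hM hx)).ge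
      have e2 := hu.integral_inner_gradient_nonneg hn hgeom hg hψ (hη'.mono hSΩ')
        fun x hx => (hη'.eq_zero (hM hx)).ge
      have e3 : ∫ x in Ω, inner ℝ (Du x) (gradient (fun y => η y + (-2) * η y) x) =
          -∫ x in Ω, inner ℝ (Du x) (gradient η x) := by
        rw [← integral_neg]
        congr 1 with x
        rw [gradient_add_smul hη.differentiable hη.differentiable, inner_add_right,
          inner_smul_right]
        ring
      have e4 : ∫ x in Ω, inner ℝ (Du x) (gradient η x) =
          ∫ x in S, inner ℝ (q x) (gradient η x) := by
        rw [setIntegral_eq_of_subset_of_forall_sdiff_eq_zero hgeom.domain.isOpen.measurableSet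
          hSΩ' fun x hx => by rw [hη.gradient_eq_zero hx.2, inner_zero_right]]
        refine integral_congr_ae ?_
        filter_upwards [ae_mono (Measure.restrict_mono hSΩ' le_rfl) hq] with x hx
        rw [hx]
      have e5 := hd.2 η hη
      simp only [smul_eq_mul, mul_comm (η _)]
      linarith)
  filter_upwards [this, ae_restrict_mem hS.measurableSet] with x h1 h2 using h1 h2

/-- The conditions satisfied by the jump of the normal derivative of a minimizer. -/
theorem IsMinimizer.ae_complementarity (hn : 1 ≤ n) (hgeom : IsDividedDomain Ω Ωp Ωm M)
    (hψs : IsSmoothOn M ψ) (hu : IsMinimizer Ω M φ Dφ ψ u Du) (hg : IsTrace Ω M u Du g)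
    (hψ : ∀ᵐ x ∂(surf Ω M), ψ x ≤ g x) {C : ℝ} (hC : IsTraceConst Ω M Ωp C)
    {q : Euc n → Euc n} {d j : Euc n → ℝ} (hq : IsHDiv Ω Ωp Ωm M q d j)
    (hqu : q =ᵐ[volume.restrict Ω] Du) (hdp : d =ᵐ[volume.restrict Ωp] 0)
    (hdm : d =ᵐ[volume.restrict Ωm] 0) :
    ∀ᵐ x ∂(surf Ω M), 0 ≤ j x ∧ j x * (g x - ψ x) = 0 := by
  -- With zero divergence on both pieces, Green's formula identifies the first variation of the
  -- energy at `u` with integration against `j` over `M`.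
  have green {w h : Euc n → ℝ} {Dw : Euc n → Euc n} (hw : IsH10 Ω w Dw)
      (hh : IsTrace Ω M w Dw h) :
      ∫ x in Ω, inner ℝ (Du x) (Dw x) = ∫ x, j x * h x ∂(surf Ω M) := by
    have e1 : ∫ x in Ω, inner ℝ (q x) (Dw x) = ∫ x in Ω, inner ℝ (Du x) (Dw x) :=
      integral_congr_ae (by filter_upwards [hqu] with x hx; rw [hx])
    have e2 {S : Set (Euc n)} (hd : d =ᵐ[volume.restrict S] 0) : ∫ x in S, d x * w x = 0 :=
      integral_eq_zero_of_ae (by filter_upwards [hd] with x hx; simp [hx])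
    rw [← hq.integral_inner_add hn hgeom hC hw hh, e1, e2 hdp, e2 hdm]
    simp
  have hj : ∀ᵐ x ∂(surf Ω M), 0 ≤ j x := by
    refine ae_nonneg_of_integral_test_nonneg hgeom.domain.isOpen
      ((ae_surf_mem hgeom).mono fun x hx => hx.2) (fun η hη => hη.memLp_surf hn hgeom)
      hq.memLp_jump fun η hη h0 => ?_
    rw [← green hη.isH10 (hη.isTrace hn hgeom)]
    exact hu.integral_inner_gradient_nonneg hn hgeom hg hψ hη fun x _ => h0 x
  have hloc : surf Ω M {x | ¬ (x ∈ M ∩ Ω → j x * (g x - ψ x) = 0)} = 0 := by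
    refine measure_null_of_locally_null _ fun x hx => ?_
    have hxM : x ∈ M ∩ Ω := by
      by_contra h'
      exact hx fun h'' => absurd h'' h'
    obtain ⟨U, Ψ, hU, hxU, hΨ, hψΨ⟩ := hψs x hxM.1
    obtain ⟨ζ, hζs, hζc, hζ, hζr, hζx⟩ := exists_contDiff_tsupport_subset (n := ⊤)
      ((hgeom.domain.isOpen.inter hU).mem_nhds ⟨hxM.2, hxU⟩)
    have hζt : IsTest Ω ζ := ⟨hζ, hζc, hζs.trans Set.inter_subset_left⟩
    have hζU : IsTest U ζ := ⟨hζ, hζc, hζs.trans Set.inter_subset_right⟩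
    have hζ01 (y : Euc n) : ζ y ∈ Set.Icc (0 : ℝ) 1 := hζr (Set.mem_range_self y)
    have hζΨ : IsTest Ω (fun y => ζ y * Ψ y) := hζt.mul hΨ
    obtain ⟨hζu, hζg⟩ := hg.test_mul hζt hu.1.1
    -- The variation `ζ(Ψ - u)` pushes `u` towards the obstacle near `x`; since `ζ ≤ 1`, the trace
    -- stays above `ψ`. The local extension `Ψ` is needed because `ψ` is smooth only on `M`.
    have hw := hζΨ.isH10.sub hζu
    have hwt := IsTrace.sub hζΨ.isH10.1 hζu.1 (hζΨ.isTrace hn hgeom) hζg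
    have hΨψ : ∀ᵐ y ∂(surf Ω M), ζ y * Ψ y = ζ y * ψ y := by
      filter_upwards [ae_surf_mem hgeom] with y hy
      by_cases hyU : y ∈ U
      · rw [hψΨ y ⟨hy.1, hyU⟩]
      · rw [hζU.eq_zero hyU, zero_mul, zero_mul]
    have h0 := hu.integral_inner_nonneg hg hψ hw hwt (by
      filter_upwards [hψ, hΨψ] with y h1 h2
      rw [h2]
      nlinarith [(hζ01 y).2])
    rw [green hw hwt] at h0
    have hint := integrable_mul_of_memLp hq.memLp_jump hwt.1
    have hneg : 0 ≤ᵐ[surf Ω M] fun y => -(j y * (ζ y * Ψ y - ζ y * g y)) := by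
      filter_upwards [hψ, hΨψ, hj] with y h1 h2 h3
      rw [h2]
      have : 0 ≤ j y * (ζ y * (g y - ψ y)) :=
        mul_nonneg h3 (mul_nonneg (hζ01 y).1 (sub_nonneg.2 h1))
      simp only [Pi.zero_apply]
      linarith
    -- The variational inequality gives one sign of the integral, and `j ≥ 0` with `u ≥ ψ` on `M`
    -- gives the other, so the nonnegative integrand `ζ j (u - ψ)` vanishes a.e.
    have h1 : ∫ y, -(j y * (ζ y * Ψ y - ζ y * g y)) ∂(surf Ω M) = 0 := by
      refine le_antisymm ?_ (integral_nonneg_of_ae hneg)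
      rw [integral_neg]
      linarith
    rw [integral_eq_zero_iff_of_nonneg_ae hneg hint.neg] at h1
    have h2 : ∀ᵐ y ∂(surf Ω M), ζ y ≠ 0 → j y * (g y - ψ y) = 0 := by
      filter_upwards [h1, hΨψ] with y h3 h4 h5
      rw [h4] at h3
      simp only [Pi.zero_apply] at h3
      have : ζ y * (j y * (g y - ψ y)) = 0 := by linarith
      exact (mul_eq_zero.1 this).resolve_left h5
    have hopen : {y | ζ y ≠ 0} ∈ 𝓝 x :=
      hζ.continuous.continuousAt.eventually_ne (by rw [hζx]; exact one_ne_zero)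
    refine ⟨_, inter_mem_nhdsWithin _ hopen, measure_mono_null (fun y hy => ?_) (ae_iff.1 h2)⟩
    intro h3
    exact hy.1 fun _ => h3 hy.2
  filter_upwards [hj, ae_surf_mem hgeom, ae_iff.2 hloc] with x h1 h2 h3 using ⟨h1, h3 h2⟩

end Minimizer

end ThinObstacle
namespace ThinObstacle

/-! ### The error estimate and the zero set of the majorant -/

section Majorant

variable {n : ℕ} {Ω Ωp Ωm M : Set (Euc n)} {CFp CFm β₁ β₂ C : ℝ} {Dv q : Euc n → Euc n}
  {d g ψ j : Euc n → ℝ}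

theorem majorant₁_nonneg (h₁ : 0 < β₁) (h₂ : 0 < β₂) :
    0 ≤ majorant₁ Ω Ωp Ωm CFp CFm β₁ β₂ Dv q d := by
  unfold majorant₁
  positivity

theorem majorant₃_nonneg (hC : 0 < C) (h₁ : 0 < β₁) (h₂ : 0 < β₂)
    (h : ∀ᵐ x ∂(surf Ω M), 0 ≤ g x - ψ x) : 0 ≤ majorant₃ Ω M C β₁ β₂ g ψ j :=
  integral_nonneg_of_ae (h.mono fun _ hx => rho_nonneg hC (cBeta_pos h₁ h₂) hx)

end Majorant

section Estimate

variable {n : ℕ} {Ω Ωp Ωm M : Set (Euc n)} {u v w φ : Euc n → ℝ} {Du Dv Dw Dφ : Euc n → Euc n}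
  {ψ : Euc n → ℝ}

theorem IsFriedrichsConst.abs_integral_mul_le {S : Set (Euc n)} {C : ℝ}
    (hC : IsFriedrichsConst Ω S C) (hS : S ⊆ Ω) {d : Euc n → ℝ} (hd : MemLp d 2 (volume.restrict S))
    (hw : IsH10 Ω w Dw) :
    |∫ x in S, d x * w x| ≤ C * l2norm (volume.restrict S) d * l2norm (volume.restrict Ω) Dw := by
  have hle : volume.restrict S ≤ volume.restrict Ω := Measure.restrict_mono hS le_rfl
  have h1 : l2norm (volume.restrict S) w ≤ C * l2norm (volume.restrict Ω) Dw :=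
    (hC.2 w Dw hw).trans (mul_le_mul_of_nonneg_left (l2norm_mono hle hw.1.memLp_grad) hC.1.le)
  calc |∫ x in S, d x * w x| ≤ l2norm (volume.restrict S) d * l2norm (volume.restrict S) w :=
        ThinObstacle.abs_integral_mul_le hd (hw.1.memLp.mono_measure hle)
    _ ≤ l2norm (volume.restrict S) d * (C * l2norm (volume.restrict Ω) Dw) :=
        mul_le_mul_of_nonneg_left h1 (l2norm_nonneg _ _)
    _ = _ := by ring

theorem IsTraceConst.l2norm_le {S : Set (Euc n)} {C : ℝ} (hC : IsTraceConst Ω M S C)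
    (hS : S ⊆ Ω) {h : Euc n → ℝ} (hw : IsH10 Ω w Dw) (hh : IsTrace Ω M w Dw h) :
    l2norm (surf Ω M) h ≤ C * l2norm (volume.restrict Ω) Dw :=
  (hC.2 w Dw h hw hh).trans (mul_le_mul_of_nonneg_left
    (l2norm_mono (Measure.restrict_mono hS le_rfl) hw.1.memLp_grad) hC.1.le)

/-- The a posteriori error estimate. -/
theorem IsMinimizer.l2norm_sub_sq_le (hn : 1 ≤ n) (hgeom : IsDividedDomain Ω Ωp Ωm M)
    (hψ : IsSmoothOn M ψ) (hu : IsMinimizer Ω M φ Dφ ψ u Du) {CFp CFm CTp CTm : ℝ}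
    (hCFp : IsFriedrichsConst Ω Ωp CFp) (hCFm : IsFriedrichsConst Ω Ωm CFm)
    (hCTp : IsTraceConst Ω M Ωp CTp) (hCTm : IsTraceConst Ω M Ωm CTm)
    (hv : IsAdmissible Ω M φ Dφ ψ v Dv) {g : Euc n → ℝ} (hg : IsTrace Ω M v Dv g)
    {q : Euc n → Euc n} {d j : Euc n → ℝ} (hq : IsHDiv Ω Ωp Ωm M q d j) {β₁ β₂ : ℝ}
    (hβ₁ : 0 < β₁) (hβ₂ : 0 < β₂) :
    l2norm (volume.restrict Ω) (fun x => Dv x - Du x) ^ 2 ≤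
      majorant₁ Ω Ωp Ωm CFp CFm β₁ β₂ Dv q d + majorant₃ Ω M (min CTp CTm) β₁ β₂ g ψ j := by
  have hψg := hv.le_trace hCTp hgeom.plus_subset hg
  obtain ⟨gu, hgu, hψu⟩ := hu.1.2.2
  have hw := hv.sub hu.1
  have hh := IsTrace.sub hv.1 hu.1.1 hg hgu
  set Dw : Euc n → Euc n := fun x => Dv x - Du x with hDwdef
  set h : Euc n → ℝ := fun x => g x - gu x with hhdef
  set N := l2norm (volume.restrict Ω) Dw
  have hC : 0 < min CTp CTm := lt_min hCTp.1 hCTm.1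
  have hc := cBeta_pos hβ₁ hβ₂
  have hvar : 0 ≤ ∫ x in Ω, inner ℝ (Du x) (Dw x) :=
    hu.integral_inner_nonneg hgu hψu hw hh (by
      filter_upwards [hψg] with x hx
      simpa [h] using hx)
  -- Each trace constant works with the norm over all of `Ω`, so the smaller one does too.
  have hN : l2norm (surf Ω M) h ≤ min CTp CTm * N := by
    rcases min_choice CTp CTm with e | e <;> rw [e]
    exacts [hCTp.l2norm_le hgeom.plus_subset hw hh, hCTm.l2norm_le hgeom.minus_subset hw hh]
  obtain ⟨D, hD⟩ := two_mul_integral_mul_le (t := fun x => g x - ψ x) hC hc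
    (hψg.mono fun x hx => sub_nonneg.2 hx)
    (hg.1.1.sub (hψ.aestronglyMeasurable hgeom)) hq.memLp_jump hh.1
    (hψu.mono fun x hx => sub_le_sub_left hx _) hN
  have hgreen := hq.integral_inner_add hn hgeom hCTp hw hh
  have hp := hCFp.abs_integral_mul_le hgeom.plus_subset hq.div_plus.1 hw
  have hm := hCFm.abs_integral_mul_le hgeom.minus_subset hq.div_minus.1 hw
  have hvq := (le_abs_self _).trans (abs_integral_inner_le (hv.1.memLp_grad.sub hq.memLp)
    hw.1.memLp_grad)
  have hsplit : N ^ 2 = (∫ x in Ω, inner ℝ ((Dv - q) x) (Dw x)) +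
      (∫ x in Ω, inner ℝ (q x) (Dw x)) - ∫ x in Ω, inner ℝ (Du x) (Dw x) := by
    have i1 := integrable_inner (hv.1.memLp_grad.sub hq.memLp) hw.1.memLp_grad
    have i2 := integrable_inner hq.memLp hw.1.memLp_grad
    have i3 := integrable_inner hu.1.1.memLp_grad hw.1.memLp_grad
    rw [← integral_add i1 i2, ← integral_sub (by exact i1.add i2) i3,
      show N ^ 2 = _ from l2norm_sq hw.1.memLp_grad]
    congr 1 with x
    rw [← inner_add_left, ← inner_sub_left, ← real_inner_self_eq_norm_sq]
    simp [Dw]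
  set A := l2norm (volume.restrict Ω) (Dv - q)
  set Bp := CFp * l2norm (volume.restrict Ωp) d
  set Bm := CFm * l2norm (volume.restrict Ωm) d
  have hyoung := sq_add_add_le hβ₁ hβ₂ A (Bp + Bm) D
  -- The bounds so far give `2N² ≤ 2(A + Bp + Bm + D)N + 𝔐₃ - D²/c_β`. This step absorbs one `N²`,
  -- and `hyoung` then cancels `D²/c_β`.
  have hfin : 2 * ((A + (Bp + Bm) + D) * N) ≤ N ^ 2 + (A + (Bp + Bm) + D) ^ 2 := by
    nlinarith [sq_nonneg (A + (Bp + Bm) + D - N)]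
  have hp' := neg_le_of_abs_le hp
  have hm' := neg_le_of_abs_le hm
  have hM₁ : majorant₁ Ω Ωp Ωm CFp CFm β₁ β₂ Dv q d =
      (1 + β₁) * A ^ 2 + (1 + β₁⁻¹) * (1 + β₂) * (Bp + Bm) ^ 2 := rfl
  rw [hM₁, majorant₃]
  linarith

/-- The majorant vanishes only at the minimizer and its flux. -/
theorem IsMinimizer.ae_eq_of_majorant_eq_zero (hgeom : IsDividedDomain Ω Ωp Ωm M)
    (hu : IsMinimizer Ω M φ Dφ ψ u Du) {CFp CFm β₁ β₂ : ℝ}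
    (hCFp : IsFriedrichsConst Ω Ωp CFp) (hCFm : IsFriedrichsConst Ω Ωm CFm)
    (hv : IsAdmissible Ω M φ Dφ ψ v Dv) {q : Euc n → Euc n} {d : Euc n → ℝ}
    (hq : MemLp q 2 (volume.restrict Ω)) (hβ₁ : 0 < β₁) (hβ₂ : 0 < β₂)
    (hM : majorant₁ Ω Ωp Ωm CFp CFm β₁ β₂ Dv q d = 0)
    (hD : l2norm (volume.restrict Ω) (fun x => Dv x - Du x) = 0) :
    v =ᵐ[volume.restrict Ω] u ∧ q =ᵐ[volume.restrict Ω] Du := by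
  have hw := hv.sub hu.1
  have hDvu := ae_eq_zero_of_l2norm_eq_zero hw.1.memLp_grad hD
  constructor
  -- The Friedrichs inequalities hold on each piece separately; `M` is null, so together they cover
  -- `Ω`.
  · have key {S : Set (Euc n)} {C : ℝ} (hC : IsFriedrichsConst Ω S C) (hS : S ⊆ Ω) :
        ∀ᵐ x ∂volume.restrict S, v x = u x := by
      have hle : volume.restrict S ≤ volume.restrict Ω := Measure.restrict_mono hS le_rfl
      have h1 := hC.2 _ _ hw
      rw [l2norm_eq_zero_of_ae_eq_zero (ae_mono hle hDvu), mul_zero] at h1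
      filter_upwards [ae_eq_zero_of_l2norm_eq_zero (hw.1.memLp.mono_measure hle)
        (le_antisymm h1 (l2norm_nonneg _ _))] with x hx
      exact sub_eq_zero.1 hx
    rw [hgeom.restrict_eq]
    exact (ae_restrict_union_iff _ _ _).2 ⟨key hCFp hgeom.plus_subset, key hCFm hgeom.minus_subset⟩
  · have h1 : (1 + β₁) * l2norm (volume.restrict Ω) (fun x => Dv x - q x) ^ 2 = 0 := by
      refine le_antisymm ?_ (by positivity)
      rw [← hM, majorant₁]
      exact le_add_of_nonneg_right (by positivity)
    have h2 : l2norm (volume.restrict Ω) (fun x => Dv x - q x) = 0 :=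
      pow_eq_zero_iff two_ne_zero |>.1 ((mul_eq_zero.1 h1).resolve_left (by positivity))
    filter_upwards [hDvu, ae_eq_zero_of_l2norm_eq_zero (hv.1.memLp_grad.sub hq) h2] with x h3 h4
    exact (sub_eq_zero.1 h4).symm.trans (sub_eq_zero.1 h3)

/-- The majorant vanishes at the minimizer and its flux. -/
theorem IsMinimizer.majorant_eq_zero (hn : 1 ≤ n) (hgeom : IsDividedDomain Ω Ωp Ωm M)
    (hψ : IsSmoothOn M ψ) (hu : IsMinimizer Ω M φ Dφ ψ u Du) {C CT CFp CFm β₁ β₂ : ℝ}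
    (hCT : IsTraceConst Ω M Ωp CT) (hC : 0 < C) (hv : IsAdmissible Ω M φ Dφ ψ v Dv)
    {g : Euc n → ℝ} (hg : IsTrace Ω M v Dv g)
    {q : Euc n → Euc n} {d j : Euc n → ℝ} (hq : IsHDiv Ω Ωp Ωm M q d j)
    (hβ₁ : 0 < β₁) (hβ₂ : 0 < β₂)
    (hvu : v =ᵐ[volume.restrict Ω] u) (hqu : q =ᵐ[volume.restrict Ω] Du) :
    majorant₁ Ω Ωp Ωm CFp CFm β₁ β₂ Dv q d = 0 ∧ majorant₃ Ω M C β₁ β₂ g ψ j = 0 := by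
  -- Only `v = u` a.e. is given: uniqueness of weak gradients, then of traces, transfers the
  -- equality to `Dv` and to `g`.
  have hDvu := hv.1.ae_eq hgeom.domain.isOpen hu.1.1 hvu
  have hψg := hv.le_trace hCT hgeom.plus_subset hg
  obtain ⟨gu, hgu, hψu⟩ := hu.1.2.2
  have hgg := (IsTrace.sub hv.1 hu.1.1 hg hgu).ae_eq_zero hCT hgeom.plus_subset (hv.sub hu.1)
    (by filter_upwards [hDvu] with x hx; exact sub_eq_zero.2 hx)
  have hdp : d =ᵐ[volume.restrict Ωp] 0 :=
    hu.ae_div_eq_zero hn hgeom hgu hψu hgeom.domain_plus.isOpen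
      (hgeom.union_eq ▸ Set.subset_union_left) hq.div_plus hqu
  have hdm : d =ᵐ[volume.restrict Ωm] 0 :=
    hu.ae_div_eq_zero hn hgeom hgu hψu hgeom.domain_minus.isOpen
      (hgeom.union_eq ▸ Set.subset_union_right) hq.div_minus hqu
  have hcomp := hu.ae_complementarity hn hgeom hψ hgu hψu hCT hq hqu hdp hdm
  constructor
  · rw [majorant₁, l2norm_eq_zero_of_ae_eq_zero hdp, l2norm_eq_zero_of_ae_eq_zero hdm,
      l2norm_eq_zero_of_ae_eq_zero (f := fun x => Dv x - q x)]
    · simp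
    · filter_upwards [hDvu, hqu] with x h1 h2
      rw [h1, h2, sub_self, Pi.zero_apply]
  · refine integral_eq_zero_of_ae ?_
    filter_upwards [hcomp, hψg, hgg] with x h1 h2 h3
    refine rho_eq_zero hC (cBeta_pos hβ₁ hβ₂) (sub_nonneg.2 h2) h1.1 ?_
    rw [sub_eq_zero.1 h3]
    exact h1.2

end Estimate

end ThinObstacle

theorem theorem2p7 {n : ℕ} (hn : 1 ≤ n)
    (Ω Ωp Ωm M : Set (ThinObstacle.Euc n))
    (hgeom : ThinObstacle.IsDividedDomain Ω Ωp Ωm M)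
    (φ : ThinObstacle.Euc n → ℝ) (Dφ : ThinObstacle.Euc n → ThinObstacle.Euc n)
    (hφ : ThinObstacle.IsH1 Ω φ Dφ)
    (ψ : ThinObstacle.Euc n → ℝ) (hψ : ThinObstacle.IsSmoothOn M ψ)
    (u : ThinObstacle.Euc n → ℝ) (Du : ThinObstacle.Euc n → ThinObstacle.Euc n)
    (hu : ThinObstacle.IsMinimizer Ω M φ Dφ ψ u Du)
    (CFp CFm CTp CTm : ℝ)
    (hCFp : ThinObstacle.IsFriedrichsConst Ω Ωp CFp)
    (hCFm : ThinObstacle.IsFriedrichsConst Ω Ωm CFm)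
    (hCTp : ThinObstacle.IsTraceConst Ω M Ωp CTp)
    (hCTm : ThinObstacle.IsTraceConst Ω M Ωm CTm)
    (v : ThinObstacle.Euc n → ℝ) (Dv : ThinObstacle.Euc n → ThinObstacle.Euc n)
    (hv : ThinObstacle.IsAdmissible Ω M φ Dφ ψ v Dv)
    (trv : ThinObstacle.Euc n → ℝ) (htrv : ThinObstacle.IsTrace Ω M v Dv trv)
    (q : ThinObstacle.Euc n → ThinObstacle.Euc n) (d j : ThinObstacle.Euc n → ℝ)
    (hq : ThinObstacle.IsHDiv Ω Ωp Ωm M q d j)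
    (β₁ β₂ : ℝ) (hβ₁ : 0 < β₁) (hβ₂ : 0 < β₂) :
    MeasureTheory.Integrable
      (fun x => ThinObstacle.rho (min CTp CTm) (ThinObstacle.cBeta β₁ β₂) (trv x - ψ x) (j x))
      (ThinObstacle.surf Ω M) ∧
    ThinObstacle.l2norm (MeasureTheory.volume.restrict Ω) (fun x => Dv x - Du x) ^ 2 ≤
      ThinObstacle.majorant₁ Ω Ωp Ωm CFp CFm β₁ β₂ Dv q d +
        ThinObstacle.majorant₃ Ω M (min CTp CTm) β₁ β₂ trv ψ j ∧
    (ThinObstacle.majorant₁ Ω Ωp Ωm CFp CFm β₁ β₂ Dv q d +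
        ThinObstacle.majorant₃ Ω M (min CTp CTm) β₁ β₂ trv ψ j = 0 ↔
      v =ᵐ[MeasureTheory.volume.restrict Ω] u ∧ q =ᵐ[MeasureTheory.volume.restrict Ω] Du) := by
  open ThinObstacle in
  have hC : 0 < min CTp CTm := lt_min hCTp.1 hCTm.1
  have hc := cBeta_pos hβ₁ hβ₂
  have ht : ∀ᵐ x ∂(surf Ω M), 0 ≤ trv x - ψ x :=
    (hv.le_trace hCTp hgeom.plus_subset htrv).mono fun x hx => sub_nonneg.2 hx
  have hle := hu.l2norm_sub_sq_le hn hgeom hψ hCFp hCFm hCTp hCTm hv htrv hq hβ₁ hβ₂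
  refine ⟨integrable_rho hC hc ht (htrv.1.1.sub (hψ.aestronglyMeasurable hgeom)) hq.memLp_jump,
    hle, fun h0 => ?_, fun h => ?_⟩
  · have h1 := majorant₁_nonneg (Ω := Ω) (Ωp := Ωp) (Ωm := Ωm) (CFp := CFp) (CFm := CFm)
      (Dv := Dv) (q := q) (d := d) hβ₁ hβ₂
    have h3 := majorant₃_nonneg (j := j) hC hβ₁ hβ₂ ht
    rw [h0] at hle
    exact hu.ae_eq_of_majorant_eq_zero hgeom hCFp hCFm hv hq.memLp hβ₁ hβ₂ (by linarith)
      (pow_eq_zero_iff two_ne_zero |>.1 (le_antisymm hle (sq_nonneg _)))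
  · obtain ⟨h1, h3⟩ := hu.majorant_eq_zero (CFp := CFp) (CFm := CFm) hn hgeom hψ hCTp hC hv htrv hq
      hβ₁ hβ₂ h.1 h.2
    rw [h1, h3, add_zero]
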